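/- **Setting.** Let $h:\mathbb{R}^p\times\mathbb{R}^r\to\mathbb{R}^q$ be differentiable in its first argument ($p\ge 1$), let $d_k\in\mathbb{R}^r$ and let $\Phi_k:\mathbb{R}^p\times\mathbb{R}^q\to\mathbb{R}$ be differentiable, $k\in\mathbb{N}=\{0,1,2,\dots\}$. Put $\tilde\Phi_k(u)=\Phi_k(u,h(u,d_k))$. Norms of vectors are Euclidean, norms of matrices are spectral. Assume: * $\mathcal{U}\subset\mathbb{R}^p$ is nonempty, closed and convex, and $\|u_1-u_2\|\le D$ for all $u_1,u_2\in\mathcal{U}$, where $D>0$; * $\tilde\Phi_k$ is convex, $L_k$-smooth (its gradient is $L_k$-Lipschitz) and $M_k$-Lipschitz on $\mathbb{R}^p$, and $\Phi_k(u,y)$ is $M_{\Phi,k}$-Lipschitz in $y$, with $L_k\le\bar L$, $M_k\le\bar M$, $M_{\Phi,k}\le\bar M_\Phi$ for all $k$; * $|\tilde\Phi_k(u+\tau v)|\le G$ for all $k$, all $u\in\mathcal{U}$ and all $v$ with $\|v\|\le1$, where $\tau>0$ and $G\ge 0$. Let $u_k^*\in\mathcal{U}$ be a minimizer of $\tilde\Phi_k$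 over $\mathcal{U}$, for every $k$. Fix $T\ge 1$, and consider the running gray-box controller $$w_{k+1}=\mathrm{proj}_{\mathcal U}(w_k-\eta\hat\phi_k),\qquad u_k=w_k+\delta v_k,\qquad y_k=h(u_k,d_k),$$ $$\hat\phi_k=\alpha_k\big(\nabla_u\Phi_k(u_k,y_k)+\hat H_k^\top\nabla_y\Phi_k(u_k,y_k)\big)+(1-\alpha_k)\frac{p\,v_k}{\delta}\big(\Phi_k(u_k,y_k)-\Phi_{k-1}(u_{k-1},y_{k-1})\big)$$ for $k\ge0$, where $w_0\in\mathcal{U}$, the value $\Phi_{-1}(u_{-1},y_{-1})$ used at $k=0$ is an arbitrary initial datum, $\alpha_k\in[0,1]$, the $v_k$ are i.i.d. uniform on the unit sphere of $\mathbb{R}^p$, and $\hat H_k\in\mathbb{R}^{q\times p}$ is an approximate sensitivity which may depend on the information available up to time $k$ (of which $v_{k+1}$ is independent; the initial datum belongs to the information at time $0$). Let $\epsilon_{H,k}=\|\hat H_k-\nabla_u h(u_k,d_k)\|$ and take $$\eta=\frac{1}{p^{2/3}T^{3/4}},\qquad \delta=\min\Big(\frac{p^{1/3}}{T^{1/4}},\tau\Big).$$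 Let $C_T=\sum_{k=1}^T\|u_k^*-u_{k-1}^*\|$ and $\mathrm{Reg}=\sum_{k=1}^T\big(\mathbb{E}[\tilde\Phi_k(w_k)]-\tilde\Phi_k(u_k^*)\big)$. **Theorem.** Consider the following conditions on the sensitivity errors, required almost surely for $k=1,\dots,T$, with $\bar\epsilon>0$: (a) $\epsilon_{H,k}\le\bar\epsilon/(k+1)^{\theta}$ for some $\theta\ge\frac14$; (b) $\epsilon_{H,k}\le\bar\epsilon$; (c) $\epsilon_{H,k}\le\bar\epsilon/(k+1)^{\theta}$ for some $\theta\in(0,\frac14)$. If (a), (b) or (c) holds, then $$\mathrm{Reg}=\mathcal{O}\Big(p^{2/3}T^{3/4}(C_T+1)+\sum_{k=1}^T\alpha_k\,\mathbb{E}[\epsilon_{H,k}]\Big).$$ Let $C>0$. If (b) holds and $\alpha_k=\min\{C/(k+1)^{1/4},1\}$ for all $k$, or if (c) holds and $\alpha_k=\min\{C/(k+1)^{1/4-\theta},1\}$ for all $k$, then $$\mathrm{Reg}=\mathcal{O}\big(p^{2/3}T^{3/4}(C_T+1)\big).$$ The constants in $\mathcal{O}(\cdot)$ depend only on $D,G,\tau,\bar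 L,\bar M,\bar M_\Phi,\bar\epsilon$ and, in the second bound, on $C$; they do not depend on $p,q,r,T$ or on the remaining data, and the bounds hold for all $p,T\ge1$. -/

import Mathlib

open MeasureTheory ProbabilityTheory

namespace GrayBox

/-- `ℝⁿ` with the Euclidean norm. -/
abbrev Vec (n : ℕ) : Type := EuclideanSpace ℝ (Fin n)

/-- The unit sphere of `ℝᵖ`. -/
abbrev UnitSphere (p : ℕ) : Type := Metric.sphere (0 : Vec p) 1

/-- The uniform distribution on the unit sphere of `ℝᵖ`: normalised surface measure. It is a
probability measure for `p ≥ 1` (for `p = 1` each of the points `1`, `-1` has mass `1/2`). -/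
noncomputable def sphereUniform (p : ℕ) : Measure (UnitSphere p) :=
  ((volume : Measure (Vec p)).toSphere Set.univ)⁻¹ • (volume : Measure (Vec p)).toSphere

/-- The set of points of `U` closest to `x`. -/
def nearestPoints {p : ℕ} (U : Set (Vec p)) (x : Vec p) : Set (Vec p) :=
  {z | z ∈ U ∧ ∀ y ∈ U, ‖x - z‖ ≤ ‖x - y‖}

open Classical in
/-- Euclidean projection to `U`: the point of `U` closest to `x`. It exists and is unique when `U`
is nonempty, closed and convex (the value `x` is used if there is no closest point). -/
noncomputable def proj {p : ℕ} (U : Set (Vec p)) (x : Vec p) : Vec p :=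
  if hx : (nearestPoints U x).Nonempty then hx.some else x

/-- Data of the constrained time-varying problems
`min Φ_k (u, y)` subject to `y = h (u, d_k)` and `u ∈ U`, for `k ∈ ℕ`. -/
structure Problem (p q r : ℕ) where
  /-- steady-state input-output map of the plant -/
  h : Vec p → Vec r → Vec q
  /-- disturbances -/
  d : ℕ → Vec r
  /-- objectives -/
  Φ : ℕ → Vec p → Vec q → ℝ
  /-- constraint set -/
  U : Set (Vec p)

namespace Problem

variable {p q r : ℕ} (P : Problem p q r)

/-- The reduced objective `u ↦ Φ_k (u, h (u, d_k))`. -/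
def reduced (k : ℕ) (u : Vec p) : ℝ := P.Φ k u (P.h u (P.d k))

/-- The input-output sensitivity `∇_u h (u, d_k)` of the plant, as a linear map `ℝᵖ → ℝ^q`. -/
noncomputable def sensitivity (k : ℕ) (u : Vec p) : Vec p →L[ℝ] Vec q :=
  fderiv ℝ (fun u' => P.h u' (P.d k)) u

/-- `u` is an optimal point of the problem at time `k`. -/
def IsOptimal (k : ℕ) (u : Vec p) : Prop := u ∈ P.U ∧ ∀ u' ∈ P.U, P.reduced k u ≤ P.reduced k u'

/-- Assumptions on the plant, the constraint set (with diameter bound `D`) and the objectives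
(bounded by `G` on the `τ`-inflation of the constraint set), with smoothness and Lipschitz
constants `L k`, `M k`, `MΦ k`. -/
structure Regular (D G τ : ℝ) (L M MΦ : ℕ → ℝ) : Prop where
  h_diff : ∀ d, Differentiable ℝ (fun u => P.h u d)
  Φ_diff : ∀ k, Differentiable ℝ (fun x : Vec p × Vec q => P.Φ k x.1 x.2)
  U_closed : IsClosed P.U
  U_convex : Convex ℝ P.U
  U_diam : ∀ u₁ ∈ P.U, ∀ u₂ ∈ P.U, ‖u₁ - u₂‖ ≤ D
  reduced_convex : ∀ k, ConvexOn ℝ Set.univ (P.reduced k)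
  reduced_diff : ∀ k, Differentiable ℝ (P.reduced k)
  reduced_smooth : ∀ k u₁ u₂,
    ‖gradient (P.reduced k) u₁ - gradient (P.reduced k) u₂‖ ≤ L k * ‖u₁ - u₂‖
  reduced_lipschitz : ∀ k u₁ u₂, |P.reduced k u₁ - P.reduced k u₂| ≤ M k * ‖u₁ - u₂‖
  Φ_lipschitz : ∀ k u y₁ y₂, |P.Φ k u y₁ - P.Φ k u y₂| ≤ MΦ k * ‖y₁ - y₂‖
  reduced_bounded : ∀ k, ∀ u ∈ P.U, ∀ v : Vec p, ‖v‖ ≤ 1 → |P.reduced k (u + τ • v)| ≤ G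

/-- The inexact gradient `∇_u Φ_k (u, y) + Ĥᵀ ∇_y Φ_k (u, y)` built from an approximate
sensitivity `Ĥ`. -/
noncomputable def modelBasedDir (k : ℕ) (Ĥ : Vec p →L[ℝ] Vec q) (u : Vec p) (y : Vec q) : Vec p :=
  gradient (fun u' => P.Φ k u' y) u + ContinuousLinearMap.adjoint Ĥ (gradient (P.Φ k u) y)

/-- The state of the closed loop of the plant and the running projected gray-box controller, along
one realisation `v` of the exploration signal and `Ĥ` of the approximate sensitivities. At time `k`
it consists of the candidate solution `w_k` and of the previous objective value
`Φ_{k-1} (u_{k-1}, y_{k-1})`; the latter is initialised by `c₀` at time `0`. -/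
noncomputable def state (η δ : ℝ) (α : ℕ → ℝ) (w₀ : Vec p) (c₀ : ℝ)
    (Ĥ : ℕ → Vec p →L[ℝ] Vec q) (v : ℕ → Vec p) : ℕ → Vec p × ℝ
  | 0 => (w₀, c₀)
  | k + 1 =>
    let w := (state η δ α w₀ c₀ Ĥ v k).1
    let c := (state η δ α w₀ c₀ Ĥ v k).2
    let u := w + δ • v k
    let y := P.h u (P.d k)
    let φ₁ := P.modelBasedDir k (Ĥ k) u y
    let φ₂ := ((p : ℝ) / δ * (P.Φ k u y - c)) • v k
    let φ := α k • φ₁ + (1 - α k) • φ₂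
    (proj P.U (w - η • φ), P.Φ k u y)

/-- The candidate solution `w_k`. -/
noncomputable def candidate (η δ : ℝ) (α : ℕ → ℝ) (w₀ : Vec p) (c₀ : ℝ)
    (Ĥ : ℕ → Vec p →L[ℝ] Vec q) (v : ℕ → Vec p) (k : ℕ) : Vec p :=
  (P.state η δ α w₀ c₀ Ĥ v k).1

/-- The error `‖Ĥ_k - H_k‖` (operator norm) of the approximate sensitivity at time `k`, where
`H_k = ∇_u h (u_k, d_k)` and `u_k = w_k + δ v_k` is the applied input. -/
noncomputable def sensError (η δ : ℝ) (α : ℕ → ℝ) (w₀ : Vec p) (c₀ : ℝ)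
    (Ĥ : ℕ → Vec p →L[ℝ] Vec q) (v : ℕ → Vec p) (k : ℕ) : ℝ :=
  ‖Ĥ k - P.sensitivity k (P.candidate η δ α w₀ c₀ Ĥ v k + δ • v k)‖

/-- The expected dynamic regret `∑_{k=1}^T (𝔼[Φ_k (w_k, h (w_k, d_k))] - Φ_k (u*_k, h (u*_k, d_k)))`
of random candidate solutions `w` against the comparison points `ustar`. -/
noncomputable def regret {Ω : Type*} [MeasurableSpace Ω] (μ : Measure Ω) (w : ℕ → Ω → Vec p)
    (ustar : ℕ → Vec p) (T : ℕ) : ℝ :=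
  ∑ k ∈ Finset.Icc 1 T, ((∫ ω, P.reduced k (w k ω) ∂μ) - P.reduced k (ustar k))

end Problem

/-- The step size `1 / (p^{2/3} T^{3/4})`. -/
noncomputable def stepSize (p T : ℕ) : ℝ := 1 / ((p : ℝ) ^ (2 / 3 : ℝ) * (T : ℝ) ^ (3 / 4 : ℝ))

/-- The smoothing parameter `min (p^{1/3} / T^{1/4}, τ)`. -/
noncomputable def smoothing (p T : ℕ) (τ : ℝ) : ℝ :=
  min ((p : ℝ) ^ (1 / 3 : ℝ) / (T : ℝ) ^ (1 / 4 : ℝ)) τ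

/-- The path length `∑_{k=1}^T ‖u*_k - u*_{k-1}‖`. -/
noncomputable def pathLength {p : ℕ} (ustar : ℕ → Vec p) (T : ℕ) : ℝ :=
  ∑ k ∈ Finset.Icc 1 T, ‖ustar k - ustar (k - 1)‖

/-- The rate `p^{2/3} T^{3/4} (C_T + 1)`, where `C_T` is the path length. -/
noncomputable def rate {p : ℕ} (ustar : ℕ → Vec p) (T : ℕ) : ℝ :=
  (p : ℝ) ^ (2 / 3 : ℝ) * (T : ℝ) ^ (3 / 4 : ℝ) * (pathLength ustar T + 1)

/-- The exploration signal `v` is adapted to the information `ℱ`, uniform on the unit sphere at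
every time, and each sample is independent of the earlier information. In particular the `v k` are
independent and identically distributed. -/
structure IsExploration {p : ℕ} {Ω : Type*} [m : MeasurableSpace Ω] (μ : Measure Ω)
    (ℱ : Filtration ℕ m) (v : ℕ → Ω → UnitSphere p) : Prop where
  adapted : ∀ k, Measurable[ℱ k] (v k)
  law : ∀ k, μ.map (v k) = sphereUniform p
  indep : ∀ k, Indep (ℱ k) (MeasurableSpace.comap (v (k + 1)) inferInstance) μ

/-- The errors `e k` (random variables) are bounded by `εb`, almost surely, at times `1, …, T`. -/
def BoundedErr {Ω : Type*} [MeasurableSpace Ω] (μ : Measure Ω) (e : ℕ → Ω → ℝ) (T : ℕ) (εb : ℝ) :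
    Prop :=
  ∀ k ∈ Finset.Icc 1 T, ∀ᵐ ω ∂μ, e k ω ≤ εb

/-- The errors `e k` (random variables) are bounded by `εb / (k+1)^θ`, almost surely, at times
`1, …, T`. -/
def DecayErr {Ω : Type*} [MeasurableSpace Ω] (μ : Measure Ω) (e : ℕ → Ω → ℝ) (T : ℕ) (εb θ : ℝ) :
    Prop :=
  ∀ k ∈ Finset.Icc 1 T, ∀ᵐ ω ∂μ, e k ω ≤ εb / ((k : ℝ) + 1) ^ θ

end GrayBox

namespace GrayBox

/-! The controller is projected gradient descent along a biased, noisy direction φ. The projection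
is nonexpansive and fixes the points of the constraint set, so one step changes ‖w - x‖² by at most
-2η⟨φ, w - x⟩ + η²‖φ‖². It remains to bound ‖φ‖ and to show that 𝔼⟨φ, w - x⟩ dominates 𝔼 f(w) - f(x)
up to O(δ) and α times the expected sensitivity error.

The model-based direction does this on almost every realisation: by the chain rule it is the
gradient of the reduced objective at the perturbed input plus the adjoint of the sensitivity error
applied to a bounded vector (`Regular.modelBasedDir_eq`), and convexity absorbs the perturbation at
cost 2Mδ (`sub_le_fderiv_perturbed`). The zeroth-order direction does it only on average over v_k.
Instead of smoothing over a ball and using the divergence theorem, the proof differentiates the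
isometry invariance of the sphere measure. The resulting integration by parts
(`integral_sphereUniform_fderiv_rotation`, `integral_inner_mul_sphereUniform`) writes the averaged
estimate as an average of derivatives at perturbed points plus a Taylor remainder of order Lδ. The
stored past value multiplies an independent mean-zero vector and drops out. No variance recursion is
needed: objective values near the constraint set are at most G, so the zeroth-order direction has
norm at most 2Gp/δ.

Summation telescopes, and the moving comparator costs 2D times the path length C_T. Division by 2η
leaves terms of orders (1 + C_T)/η, Tδ and ηT(1 + p²/δ²), each O(p^{2/3}T^{3/4}(C_T + 1)) when δ =
p^{1/3}/T^{1/4}. If δ is truncated at τ, then T^{1/4} ≤ p^{1/3}/τ and the trivial regret bound 2GT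
suffices. With the prescribed weights, α_k times the error is O((k+1)^{-1/4}), which sums to
O(T^{3/4}). -/

theorem convexOn_add_fderiv_le {E : Type*} [NormedAddCommGroup E] [NormedSpace ℝ E] {f : E → ℝ}
    (hf : ConvexOn ℝ Set.univ f) {x : E} (hd : DifferentiableAt ℝ f x) (y : E) :
    f x + fderiv ℝ f x (y - x) ≤ f y := by
  have hline : HasDerivAt (fun t : ℝ => f (AffineMap.lineMap x y t)) (fderiv ℝ f x (y - x)) 0 := by
    have h1 : HasDerivAt (fun t : ℝ => AffineMap.lineMap x y t) (y - x) (0 : ℝ) :=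
      AffineMap.hasDerivAt_lineMap
    have h2 : HasFDerivAt f (fderiv ℝ f x) (AffineMap.lineMap x y (0 : ℝ)) := by
      simpa using hd.hasFDerivAt
    exact h2.comp_hasDerivAt (0 : ℝ) h1
  have hc : ConvexOn ℝ Set.univ (fun t : ℝ => f (AffineMap.lineMap x y t)) := by
    have := hf.comp_affineMap (AffineMap.lineMap (k := ℝ) x y)
    rwa [Set.preimage_univ] at this
  have := hc.le_slope_of_hasDerivAt (Set.mem_univ 0) (Set.mem_univ 1) one_pos hline
  simp [slope_def_field] at this
  simp
  linarith

/-! ### Euclidean projection onto a closed convex set. -/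

section Projection

variable {p : ℕ} {U : Set (Vec p)}

theorem nearestPoints_nonempty (hne : U.Nonempty) (hc : IsClosed U) (hconv : Convex ℝ U)
    (x : Vec p) : (nearestPoints U x).Nonempty := by
  obtain ⟨z, hz, hmin⟩ := exists_norm_eq_iInf_of_complete_convex hne hc.isComplete hconv x
  refine ⟨z, hz, fun y hy => ?_⟩
  rw [hmin]
  exact ciInf_le ⟨0, Set.forall_mem_range.2 fun _ => norm_nonneg _⟩ (⟨y, hy⟩ : U)

theorem proj_mem_nearestPoints (hne : U.Nonempty) (hc : IsClosed U) (hconv : Convex ℝ U)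
    (x : Vec p) : proj U x ∈ nearestPoints U x := by
  have h := nearestPoints_nonempty hne hc hconv x
  rw [proj, dif_pos h]
  exact h.some_mem

theorem proj_mem (hne : U.Nonempty) (hc : IsClosed U) (hconv : Convex ℝ U) (x : Vec p) :
    proj U x ∈ U :=
  (proj_mem_nearestPoints hne hc hconv x).1

theorem inner_sub_proj_le_zero (hc : IsClosed U) (hconv : Convex ℝ U) (x : Vec p) {y : Vec p}
    (hy : y ∈ U) : inner ℝ (x - proj U x) (y - proj U x) ≤ 0 := by
  have h := proj_mem_nearestPoints ⟨y, hy⟩ hc hconv x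
  refine (norm_eq_iInf_iff_real_inner_le_zero hconv h.1).1 ?_ y hy
  have : Nonempty U := ⟨⟨y, hy⟩⟩
  exact le_antisymm (le_ciInf fun z => h.2 z z.2)
    (ciInf_le ⟨0, Set.forall_mem_range.2 fun _ => norm_nonneg _⟩ (⟨_, h.1⟩ : U))

theorem norm_proj_sub_proj_le (hne : U.Nonempty) (hc : IsClosed U) (hconv : Convex ℝ U)
    (x y : Vec p) : ‖proj U x - proj U y‖ ≤ ‖x - y‖ := by
  have h1 := inner_sub_proj_le_zero hc hconv x (proj_mem hne hc hconv y)
  have h2 := inner_sub_proj_le_zero hc hconv y (proj_mem hne hc hconv x)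
  have h3 : ‖proj U x - proj U y‖ ^ 2 ≤ inner ℝ (x - y) (proj U x - proj U y) := by
    rw [← real_inner_self_eq_norm_sq]
    have e : inner ℝ (x - y) (proj U x - proj U y)
        - inner ℝ (proj U x - proj U y) (proj U x - proj U y)
        = -inner ℝ (x - proj U x) (proj U y - proj U x)
          - inner ℝ (y - proj U y) (proj U x - proj U y) := by
      simp only [inner_sub_left, inner_sub_right]
      ring
    linarith
  have h4 := real_inner_le_norm (x - y) (proj U x - proj U y)
  by_contra! hlt
  nlinarith [norm_nonneg (x - y)]

theorem proj_eq_self (hc : IsClosed U) (hconv : Convex ℝ U) {x : Vec p}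
    (hx : x ∈ U) : proj U x = x := by
  have h := (proj_mem_nearestPoints ⟨x, hx⟩ hc hconv x).2 x hx
  rw [sub_self, norm_zero] at h
  exact (sub_eq_zero.1 (norm_le_zero_iff.1 h)).symm

theorem norm_proj_sub_le (hc : IsClosed U) (hconv : Convex ℝ U) (x : Vec p) {y : Vec p}
    (hy : y ∈ U) : ‖proj U x - y‖ ≤ ‖x - y‖ := by
  simpa [proj_eq_self hc hconv hy] using norm_proj_sub_proj_le ⟨y, hy⟩ hc hconv x y

theorem continuous_proj (hne : U.Nonempty) (hc : IsClosed U) (hconv : Convex ℝ U) :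
    Continuous (proj U) :=
  (LipschitzWith.of_dist_le_mul (K := 1) fun x y => by
    simpa [dist_eq_norm] using norm_proj_sub_proj_le hne hc hconv x y).continuous

end Projection

/-! ### Invariance of the sphere measure and integration by parts. -/

section Sphere

variable {p : ℕ}

instance : IsFiniteMeasure (sphereUniform p) := by
  rcases Nat.eq_zero_or_pos p with rfl | hp
  -- In dimension zero the sphere is empty; the normalising factor is infinite but multiplies the
  -- zero measure.
  · have : (volume : Measure (Vec 0)).toSphere = 0 := by
      rw [Measure.toSphere_eq_zero_iff]; infer_instance
    rw [sphereUniform, this, smul_zero]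
    infer_instance
  · have : Nontrivial (Vec p) := by
      have : Nonempty (Fin p) := ⟨⟨0, hp⟩⟩
      infer_instance
    refine ⟨?_⟩
    rw [sphereUniform, Measure.smul_apply, smul_eq_mul, ENNReal.inv_mul_cancel]
    · exact ENNReal.one_lt_top
    · exact (Measure.measure_univ_ne_zero).2 (Measure.toSphere_ne_zero _)
    · exact measure_ne_top _ _

open scoped Pointwise in
-- The surface measure of a set is a multiple of the volume of the cone over it. A linear isometry
-- commutes with forming cones and preserves volume.
theorem map_val_toSphere_map (R : Vec p ≃ₗᵢ[ℝ] Vec p) :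
    (((volume : Measure (Vec p)).toSphere).map Subtype.val).map R
      = ((volume : Measure (Vec p)).toSphere).map Subtype.val := by
  ext A hA
  have hR : Measurable R := R.continuous.measurable
  have hRA : MeasurableSet (R ⁻¹' A) := hR hA
  rw [Measure.map_apply hR hA, Measure.map_apply measurable_subtype_coe hRA,
    Measure.map_apply measurable_subtype_coe hA,
    Measure.toSphere_apply' _ (measurable_subtype_coe hRA),
    Measure.toSphere_apply' _ (measurable_subtype_coe hA)]
  congr 1
  have e : (Set.Ioo (0 : ℝ) 1 • Subtype.val '' (Subtype.val ⁻¹' (R ⁻¹' A) : Set (UnitSphere p)))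
      = R ⁻¹' (Set.Ioo (0 : ℝ) 1 • Subtype.val '' (Subtype.val ⁻¹' A : Set (UnitSphere p))) := by
    ext x
    simp only [Set.mem_smul, Set.mem_preimage, Set.mem_image]
    constructor
    · rintro ⟨t, ht, _, ⟨s, hs, rfl⟩, rfl⟩
      exact ⟨t, ht, R s, ⟨⟨R s, by simp⟩, hs, rfl⟩, by simp⟩
    · rintro ⟨t, ht, _, ⟨s, hs, rfl⟩, hx⟩
      refine ⟨t, ht, R.symm s, ⟨⟨R.symm s, by simp⟩, by simpa using hs, rfl⟩, ?_⟩
      apply R.injective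
      simpa using hx
  rw [e]
  exact R.measurePreserving.measure_preimage_equiv (f := R.toMeasurableEquiv) _

/-- The uniform distribution on the sphere is invariant under linear isometries. -/
theorem integral_sphereUniform_comp_isometry (R : Vec p ≃ₗᵢ[ℝ] Vec p) (g : Vec p → ℝ) :
    ∫ s, g (R s) ∂sphereUniform p = ∫ s, g s ∂sphereUniform p := by
  have h := congrArg (fun ν => ∫ x, g x ∂ν) (map_val_toSphere_map R)
  have hval : MeasurableEmbedding (Subtype.val : UnitSphere p → Vec p) :=
    MeasurableEmbedding.subtype_coe Metric.isClosed_sphere.measurableSet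
  rw [R.toHomeomorph.measurableEmbedding.integral_map (f := R), hval.integral_map,
    hval.integral_map] at h
  rw [sphereUniform, integral_smul_measure, integral_smul_measure, h]

theorem integrable_sphereUniform {g : UnitSphere p → ℝ} (hg : Continuous g) :
    Integrable g (sphereUniform p) :=
  hg.integrable_of_hasCompactSupport (HasCompactSupport.of_compactSpace g)

/-- Integration by parts on the sphere along the infinitesimal rotation in the plane of the
orthonormal vectors `a` and `b`. -/
theorem integral_sphereUniform_fderiv_rotation {h : Vec p → ℝ} (hh : ContDiff ℝ 1 h) {a b : Vec p}
    (ha : ‖a‖ = 1) (hb : ‖b‖ = 1) (hab : inner ℝ a b = 0) :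
    ∫ s : UnitSphere p, fderiv ℝ h s (inner ℝ b (s : Vec p) • a - inner ℝ a (s : Vec p) • b)
      ∂sphereUniform p = 0 := by
  have hba : inner ℝ b a = 0 := by rw [real_inner_comm, hab]
  have haa : inner ℝ a a = 1 := by rw [real_inner_self_eq_norm_sq, ha]; norm_num
  have hbb : inner ℝ b b = 1 := by rw [real_inner_self_eq_norm_sq, hb]; norm_num
  set n : ℝ → Vec p := fun t => Real.cos t • a + Real.sin t • b with hn
  set n' : ℝ → Vec p := fun t => -Real.sin t • a + Real.cos t • b with hn'
  have hnorm : ∀ t, ‖n t‖ = 1 := by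
    intro t
    have : ‖n t‖ ^ 2 = 1 := by
      rw [← real_inner_self_eq_norm_sq]
      simp only [hn, inner_add_left, inner_add_right, inner_smul_left, inner_smul_right, haa, hbb,
        hab, hba]
      simp
      nlinarith [Real.sin_sq_add_cos_sq t]
    nlinarith [norm_nonneg (n t)]
  -- A curve of reflections in the lines spanned by n(t) replaces the rotations: each R t is visibly
  -- an isometry, and R t composed with R 0 is a rotation in the plane of a and b.
  set R : ℝ → Vec p ≃ₗᵢ[ℝ] Vec p := fun t => (ℝ ∙ n t).reflection with hRdef
  have hR : ∀ t x, R t x = (2 * inner ℝ (n t) x) • n t - x := by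
    intro t x
    simp only [hRdef, Submodule.reflection_singleton_apply, hnorm]
    simp [mul_smul, two_smul]
  set R' : ℝ → Vec p → Vec p := fun t x =>
    (2 * inner ℝ (n t) x) • n' t + (2 * inner ℝ (n' t) x) • n t with hR'
  have hnd : ∀ t, HasDerivAt n (n' t) t := fun t =>
    ((Real.hasDerivAt_cos t).smul_const a).add ((Real.hasDerivAt_sin t).smul_const b)
  have hRd : ∀ t x, HasDerivAt (fun t => R t x) (R' t x) t := by
    intro t x
    simp only [hR]
    have h1 : HasDerivAt (fun t => 2 * inner ℝ (n t) x) (2 * inner ℝ (n' t) x) t := by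
      simpa using ((hnd t).inner ℝ (hasDerivAt_const t x)).const_mul 2
    exact (h1.smul (hnd t)).sub_const x
  have hdiff : Differentiable ℝ h := hh.differentiable (by norm_num)
  have hfc : Continuous (fderiv ℝ h) := hh.continuous_fderiv (by norm_num)
  obtain ⟨B, hB⟩ := (isCompact_sphere (0 : Vec p) 1).exists_bound_of_continuousOn
    hfc.continuousOn
  have hn'norm : ∀ t, ‖n' t‖ ≤ 2 := by
    intro t
    refine (norm_add_le _ _).trans ?_
    rw [norm_smul, norm_smul, ha, hb, norm_neg, Real.norm_eq_abs, Real.norm_eq_abs]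
    linarith [Real.abs_sin_le_one t, Real.abs_cos_le_one t]
  have hder := hasDerivAt_integral_of_dominated_loc_of_deriv_le (μ := sphereUniform p)
    (F := fun t (s : UnitSphere p) => h (R t s)) (x₀ := (0 : ℝ)) (s := Set.univ)
    (F' := fun t (s : UnitSphere p) => fderiv ℝ h (R t s) (R' t s)) (bound := fun _ => B * 8)
    Filter.univ_mem
    (Filter.Eventually.of_forall fun t =>
      (hh.continuous.comp ((R t).continuous.comp continuous_subtype_val)).aestronglyMeasurable)
    (integrable_sphereUniform
      (hh.continuous.comp ((R 0).continuous.comp continuous_subtype_val)))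
    (by
      refine Continuous.aestronglyMeasurable ?_
      have h1 : Continuous fun s : UnitSphere p => R 0 (s : Vec p) :=
        (R 0).continuous.comp continuous_subtype_val
      have h2 : Continuous fun s : UnitSphere p => R' 0 (s : Vec p) := by
        simp only [hR']; fun_prop
      exact (hfc.comp h1).clm_apply h2)
    (by
      refine Filter.Eventually.of_forall fun s t _ => ?_
      have hs : ‖(s : Vec p)‖ = 1 := by simp
      have h1 : ‖fderiv ℝ h (R t s)‖ ≤ B := hB _ (by simp)
      have i1 : |inner ℝ (n t) (s : Vec p)| ≤ 1 := by
        simpa [hnorm, hs] using abs_real_inner_le_norm (n t) (s : Vec p)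
      have i2 : |inner ℝ (n' t) (s : Vec p)| ≤ 2 := by
        have := abs_real_inner_le_norm (n' t) (s : Vec p)
        rw [hs] at this
        linarith [hn'norm t]
      have h2 : ‖R' t (s : Vec p)‖ ≤ 8 := by
        refine (norm_add_le _ _).trans ?_
        rw [norm_smul, norm_smul, norm_mul, norm_mul, hnorm]
        simp only [Real.norm_eq_abs, abs_two]
        nlinarith [hn'norm t, norm_nonneg (n' t), abs_nonneg (inner ℝ (n t) (s : Vec p))]
      refine ((fderiv ℝ h (R t s)).le_opNorm _).trans ?_
      exact mul_le_mul h1 h2 (norm_nonneg _) ((norm_nonneg _).trans h1))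
    (integrable_const _)
    (Filter.Eventually.of_forall fun s t _ =>
      (hdiff (R t s)).hasFDerivAt.comp_hasDerivAt t (hRd t s))
  have hconst : (fun t => ∫ s : UnitSphere p, h (R t s) ∂sphereUniform p)
      = fun _ => ∫ s : UnitSphere p, h s ∂sphereUniform p :=
    funext fun t => integral_sphereUniform_comp_isometry (R t) h
  have hzero := hder.2
  rw [hconst] at hzero
  have hzero := hzero.unique (hasDerivAt_const _ _)
  -- The derivative at t = 0 is taken along R' 0 at the point R 0 s. In terms of y = R 0 s this
  -- vector is -2(⟨b, y⟩a - ⟨a, y⟩b), so one more use of invariance, under R 0, turns it into the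
  -- rotation field at s.
  have key := integral_sphereUniform_comp_isometry (R 0) fun x =>
    fderiv ℝ h x (inner ℝ b x • a - inner ℝ a x • b)
  rw [← key]
  have e : ∀ s : UnitSphere p, fderiv ℝ h (R 0 s) (inner ℝ b (R 0 s) • a - inner ℝ a (R 0 s) • b)
      = (-1 / 2) * fderiv ℝ h (R 0 s) (R' 0 s) := by
    intro s
    rw [← smul_eq_mul, ← map_smul]
    congr 1
    simp only [hR, hR', hn, hn', inner_sub_right, inner_smul_right]
    simp [hba, ha]
    module
  simp_rw [e]
  rw [integral_const_mul, hzero, mul_zero]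

end Sphere

/-! ### The zeroth-order estimate as an approximate subgradient. -/

section Smoothing

variable {p : ℕ} {f : Vec p → ℝ}

theorem continuous_fderiv_comp_affine (hf : ContDiff ℝ 1 f) (w : Vec p) (δ : ℝ) :
    Continuous fun s : UnitSphere p => fderiv ℝ f (w + δ • (s : Vec p)) :=
  (hf.continuous_fderiv (by norm_num)).comp (by fun_prop)

theorem continuous_comp_affine (hf : ContDiff ℝ 1 f) (w : Vec p) (δ : ℝ) :
    Continuous fun s : UnitSphere p => f (w + δ • (s : Vec p)) :=
  hf.continuous.comp (by fun_prop)

theorem integral_inner_mul_eq_of_orthonormal (hf : ContDiff ℝ 1 f) (w : Vec p) (δ : ℝ) {a b : Vec p}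
    (ha : ‖a‖ = 1) (hb : ‖b‖ = 1) (hab : inner ℝ a b = 0) :
    ∫ s : UnitSphere p, inner ℝ a (s : Vec p) * f (w + δ • (s : Vec p)) ∂sphereUniform p
      = ∫ s : UnitSphere p, δ * (inner ℝ b (s : Vec p) *
          (inner ℝ b (s : Vec p) * fderiv ℝ f (w + δ • (s : Vec p)) a
            - inner ℝ a (s : Vec p) * fderiv ℝ f (w + δ • (s : Vec p)) b)) ∂sphereUniform p := by
  have hba : inner ℝ b a = 0 := by rw [real_inner_comm, hab]
  have hbb : inner ℝ b b = 1 := by rw [real_inner_self_eq_norm_sq, hb]; norm_num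
  have hfd := hf.differentiable (by norm_num)
  -- The weight ⟨b, x⟩ is chosen because its derivative along the rotation field is -⟨a, x⟩, which
  -- produces the integrand on the left-hand side.
  have hh : ContDiff ℝ 1 fun x : Vec p => inner ℝ b x * f (w + δ • x) := by
    exact (innerSL ℝ b).contDiff.mul (hf.comp (by fun_prop))
  have hder : ∀ x u : Vec p, fderiv ℝ (fun x : Vec p => inner ℝ b x * f (w + δ • x)) x u
      = inner ℝ b x * (δ * fderiv ℝ f (w + δ • x) u) + f (w + δ • x) * inner ℝ b u := by
    intro x u
    have h1 : HasFDerivAt (fun x : Vec p => inner ℝ b x) (innerSL ℝ b) x :=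
      (innerSL ℝ b).hasFDerivAt
    have h2 : HasFDerivAt (fun x : Vec p => w + δ • x) (δ • ContinuousLinearMap.id ℝ (Vec p)) x :=
      ((hasFDerivAt_id x).const_smul δ).const_add w
    have h3 := (hfd (w + δ • x)).hasFDerivAt.comp x h2
    have h4 : HasFDerivAt (fun x : Vec p => inner ℝ b x * f (w + δ • x)) _ x := h1.mul h3
    rw [h4.fderiv]
    simp
  have key := integral_sphereUniform_fderiv_rotation hh ha hb hab
  rw [← sub_eq_zero, ← integral_sub, ← neg_eq_zero, ← integral_neg, ← key]
  · refine integral_congr_ae (Filter.Eventually.of_forall fun s => ?_)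
    simp only [hder, inner_sub_right, inner_smul_right, hba, hbb, map_sub, map_smul, smul_eq_mul]
    ring
  · have := continuous_comp_affine hf w δ
    exact integrable_sphereUniform (by fun_prop)
  · have := continuous_fderiv_comp_affine hf w δ
    exact integrable_sphereUniform (by fun_prop)

theorem sum_inner_single_mul (L : Vec p →L[ℝ] ℝ) (z : Vec p) :
    ∑ i, z i * L (EuclideanSpace.single i 1) = L z := by
  conv_rhs => rw [← (EuclideanSpace.basisFun (Fin p) ℝ).sum_repr z]
  simp

/-- A surrogate for the divergence theorem on the ball. -/
theorem integral_inner_mul_sphereUniform (hf : ContDiff ℝ 1 f) (w z : Vec p) (δ : ℝ) :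
    ((p : ℝ) - 1) *
        ∫ s : UnitSphere p, inner ℝ (s : Vec p) z * f (w + δ • (s : Vec p)) ∂sphereUniform p
      = δ * ∫ s : UnitSphere p, (fderiv ℝ f (w + δ • (s : Vec p)) z
          - inner ℝ (s : Vec p) z * fderiv ℝ f (w + δ • (s : Vec p)) s) ∂sphereUniform p := by
  have hfc := continuous_comp_affine hf w δ
  have hDc := continuous_fderiv_comp_affine hf w δ
  have hcoord : ∀ i : Fin p, ((p : ℝ) - 1) *
        ∫ s : UnitSphere p, (s : Vec p) i * f (w + δ • (s : Vec p)) ∂sphereUniform p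
      = δ * ∫ s : UnitSphere p, (fderiv ℝ f (w + δ • (s : Vec p)) (EuclideanSpace.single i 1)
          - (s : Vec p) i * fderiv ℝ f (w + δ • (s : Vec p)) s) ∂sphereUniform p := by
    intro i
    -- The planes (e_i, e_j) with j ≠ i give p - 1 copies of the same integral. The term j = i
    -- vanishes on the right, so the sum there runs over all j and the unit norm of s can be used.
    have h1 : ∀ j : Fin p, (if j = i then 0 else
        ∫ s : UnitSphere p, (s : Vec p) i * f (w + δ • (s : Vec p)) ∂sphereUniform p)
        = ∫ s : UnitSphere p, δ * ((s : Vec p) j *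
          ((s : Vec p) j * fderiv ℝ f (w + δ • (s : Vec p)) (EuclideanSpace.single i 1)
            - (s : Vec p) i * fderiv ℝ f (w + δ • (s : Vec p)) (EuclideanSpace.single j 1)))
          ∂sphereUniform p := by
      intro j
      split_ifs with hij
      · subst hij; simp
      · have := integral_inner_mul_eq_of_orthonormal hf w δ
          (a := EuclideanSpace.single i (1 : ℝ)) (b := EuclideanSpace.single j (1 : ℝ))
          (by simp) (by simp) (by simp [EuclideanSpace.inner_single_left, Ne.symm hij])
        simpa [EuclideanSpace.inner_single_left] using this
    have h2 := Finset.sum_congr (rfl : Finset.univ = (Finset.univ : Finset (Fin p)))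
      fun j _ => h1 j
    rw [← integral_finsetSum] at h2
    · have hp : 1 ≤ p := by have := i.2; omega
      rw [Finset.sum_ite, Finset.sum_const_zero, zero_add, Finset.sum_const, nsmul_eq_mul,
        Finset.filter_ne' Finset.univ i, Finset.card_erase_of_mem (Finset.mem_univ i),
        Finset.card_univ, Fintype.card_fin, Nat.cast_sub hp, Nat.cast_one] at h2
      rw [h2, ← integral_const_mul]
      refine integral_congr_ae (Filter.Eventually.of_forall fun s => ?_)
      have hs : ∑ j, (s : Vec p) j ^ 2 = 1 := by
        rw [← EuclideanSpace.real_norm_sq_eq]; simp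
      have hD := sum_inner_single_mul (fderiv ℝ f (w + δ • (s : Vec p))) (s : Vec p)
      simp only
      rw [← Finset.mul_sum, ← hD]
      congr 1
      simp only [mul_sub]
      rw [Finset.sum_sub_distrib, Finset.mul_sum]
      congr 1
      · simp_rw [← mul_assoc, ← pow_two]
        rw [← Finset.sum_mul, hs, one_mul]
      · exact Finset.sum_congr rfl fun j _ => by ring
    · intro j _
      exact integrable_sphereUniform (by fun_prop)
  have h3 := Finset.sum_congr (rfl : Finset.univ = (Finset.univ : Finset (Fin p)))
      fun i _ => congrArg (fun t => z i * t) (hcoord i)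
  simp only [mul_left_comm (z _), ← integral_const_mul (z _)] at h3
  rw [← Finset.mul_sum, ← Finset.mul_sum, ← integral_finsetSum, ← integral_finsetSum] at h3
  · have hz : ∀ s : UnitSphere p, inner ℝ (s : Vec p) z = ∑ i, z i * (s : Vec p) i := fun s => by
      simp [PiLp.inner_apply]
    have e1 : ∀ s : UnitSphere p, inner ℝ (s : Vec p) z * f (w + δ • (s : Vec p))
        = ∑ i, (s : Vec p) i * (z i * f (w + δ • (s : Vec p))) := fun s => by
      rw [hz, Finset.sum_mul]
      exact Finset.sum_congr rfl fun i _ => by ring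
    have e2 : ∀ s : UnitSphere p, fderiv ℝ f (w + δ • (s : Vec p)) z
          - inner ℝ (s : Vec p) z * fderiv ℝ f (w + δ • (s : Vec p)) s
        = ∑ i, z i * (fderiv ℝ f (w + δ • (s : Vec p)) (EuclideanSpace.single i 1)
          - (s : Vec p) i * fderiv ℝ f (w + δ • (s : Vec p)) s) := fun s => by
      simp only [mul_sub]
      rw [Finset.sum_sub_distrib, sum_inner_single_mul, hz, Finset.sum_mul]
      simp only [mul_assoc]
    simp_rw [e1, e2]
    exact h3
  · intro j _
    exact integrable_sphereUniform (by fun_prop)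
  · intro j _
    exact integrable_sphereUniform (by fun_prop)

theorem integral_inner_sphereUniform (z : Vec p) :
    ∫ s : UnitSphere p, inner ℝ (s : Vec p) z ∂sphereUniform p = 0 := by
  have h := integral_sphereUniform_comp_isometry (LinearIsometryEquiv.neg ℝ (E := Vec p))
    fun x => inner ℝ x z
  simp only [LinearIsometryEquiv.coe_neg, inner_neg_left, integral_neg] at h
  linarith

/-- At a perturbed point the gradient still gives a subgradient inequality up to an error
proportional to the perturbation. -/
theorem sub_le_fderiv_perturbed (hc : ConvexOn ℝ Set.univ f) (hfd : Differentiable ℝ f) {M : ℝ}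
    (hM : ∀ x, ‖fderiv ℝ f x‖ ≤ M) (w x d : Vec p) :
    f w - f x - 2 * M * ‖d‖ ≤ fderiv ℝ f (w + d) (w - x) := by
  -- The tangent inequalities at w + d towards x and at w towards w + d each leave a derivative
  -- along d, of size at most M‖d‖.
  have h1 := convexOn_add_fderiv_le hc (hfd (w + d)) x
  have h2 := convexOn_add_fderiv_le hc (hfd w) (w + d)
  have hb : ∀ y, |fderiv ℝ f y d| ≤ M * ‖d‖ := fun y =>
    ((fderiv ℝ f y).le_opNorm d).trans (mul_le_mul_of_nonneg_right (hM y) (norm_nonneg d))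
  have h3 := abs_le.1 (hb w)
  have h4 := abs_le.1 (hb (w + d))
  have e : fderiv ℝ f (w + d) (x - (w + d))
      = -fderiv ℝ f (w + d) (w - x) - fderiv ℝ f (w + d) d := by
    rw [← map_neg, ← map_sub]; congr 1; abel
  rw [add_sub_cancel_left] at h2
  linarith [h3.1, h4.2]

/-- First-order Taylor remainder of a convex function with Lipschitz derivative, with the
derivative taken at the endpoint. -/
theorem abs_taylor_remainder_le (hc : ConvexOn ℝ Set.univ f) (hfd : Differentiable ℝ f) {L : ℝ}
    (hL : ∀ x y, ‖fderiv ℝ f x - fderiv ℝ f y‖ ≤ L * ‖x - y‖) (w d : Vec p) :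
    |f (w + d) - f w - fderiv ℝ f (w + d) d| ≤ L * ‖d‖ ^ 2 := by
  -- Convexity at w + d makes the remainder nonpositive. Convexity at w bounds it below by the
  -- difference of the two derivatives along d.
  have h1 := convexOn_add_fderiv_le hc (hfd (w + d)) w
  have h2 := convexOn_add_fderiv_le hc (hfd w) (w + d)
  rw [add_sub_cancel_left] at h2
  rw [sub_add_cancel_left, map_neg] at h1
  have h3 := (fderiv ℝ f w - fderiv ℝ f (w + d)).le_opNorm d
  have h4 := hL w (w + d)
  rw [sub_add_cancel_left, norm_neg] at h4
  have h5 := abs_le.1 (h3.trans (mul_le_mul_of_nonneg_right h4 (norm_nonneg d)))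
  rw [_root_.sub_apply] at h5
  rw [abs_le]
  constructor <;> nlinarith [h5.1]

/-- The one-point zeroth-order estimate of the gradient, averaged over the directions, is a
subgradient of a convex function up to an error proportional to the radius. -/
theorem sub_le_integral_zeroth_order [IsProbabilityMeasure (sphereUniform p)]
    (hc : ConvexOn ℝ Set.univ f) (hf : ContDiff ℝ 1 f) {L M D : ℝ}
    (hL : ∀ x y, ‖fderiv ℝ f x - fderiv ℝ f y‖ ≤ L * ‖x - y‖) (hM : ∀ x, ‖fderiv ℝ f x‖ ≤ M)
    {δ : ℝ} (hδ : 0 < δ) {w x : Vec p} (hD : ‖w - x‖ ≤ D) (c : ℝ) :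
    f w - f x - (2 * M + L * D) * δ ≤
      ∫ s : UnitSphere p, (p : ℝ) / δ * (f (w + δ • (s : Vec p)) - c) * inner ℝ (s : Vec p) (w - x)
        ∂sphereUniform p := by
  have hfc := continuous_comp_affine hf w δ
  have hDc := continuous_fderiv_comp_affine hf w δ
  have hfd := hf.differentiable (by norm_num)
  have hdiv := integral_inner_mul_sphereUniform hf w (w - x) δ
  have hmean := integral_inner_sphereUniform (w - x)
  -- The factor p is split as (p - 1) + 1. Integration by parts treats the first part; the remaining
  -- 1/δ term combines with the radial derivative into a Taylor remainder. Both c and f w may be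
  -- inserted or removed because ⟨s, w - x⟩ has mean zero.
  have e : ∫ s : UnitSphere p, (p : ℝ) / δ * (f (w + δ • (s : Vec p)) - c)
        * inner ℝ (s : Vec p) (w - x) ∂sphereUniform p
      = ∫ s : UnitSphere p, (fderiv ℝ f (w + δ • (s : Vec p)) (w - x)
          + 1 / δ * (inner ℝ (s : Vec p) (w - x) * (f (w + δ • (s : Vec p)) - f w
            - fderiv ℝ f (w + δ • (s : Vec p)) (δ • (s : Vec p))))) ∂sphereUniform p := by
    have e1 : ∫ s : UnitSphere p, (p : ℝ) / δ * (f (w + δ • (s : Vec p)) - c)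
        * inner ℝ (s : Vec p) (w - x) ∂sphereUniform p = (p : ℝ) / δ *
        ∫ s : UnitSphere p, inner ℝ (s : Vec p) (w - x) * f (w + δ • (s : Vec p))
          ∂sphereUniform p := by
      have : ∀ s : UnitSphere p, (p : ℝ) / δ * (f (w + δ • (s : Vec p)) - c)
          * inner ℝ (s : Vec p) (w - x)
          = (p : ℝ) / δ * (inner ℝ (s : Vec p) (w - x) * f (w + δ • (s : Vec p)))
            - (p : ℝ) / δ * c * inner ℝ (s : Vec p) (w - x) := fun s => by ring
      simp_rw [this]
      rw [integral_sub, integral_const_mul, integral_const_mul, hmean, mul_zero, sub_zero]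
      · exact integrable_sphereUniform (by fun_prop)
      · exact integrable_sphereUniform (by fun_prop)
    have e2 : ∀ s : UnitSphere p, fderiv ℝ f (w + δ • (s : Vec p)) (w - x)
          + 1 / δ * (inner ℝ (s : Vec p) (w - x) * (f (w + δ • (s : Vec p)) - f w
            - fderiv ℝ f (w + δ • (s : Vec p)) (δ • (s : Vec p))))
        = (fderiv ℝ f (w + δ • (s : Vec p)) (w - x)
          - inner ℝ (s : Vec p) (w - x) * fderiv ℝ f (w + δ • (s : Vec p)) s)
          + (1 / δ * (inner ℝ (s : Vec p) (w - x) * f (w + δ • (s : Vec p)))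
            - f w / δ * inner ℝ (s : Vec p) (w - x)) := fun s => by
      rw [map_smul, smul_eq_mul]; field_simp; ring
    simp_rw [e2]
    rw [integral_add, integral_sub (f := fun s : UnitSphere p => 1 / δ * _), e1,
      integral_const_mul, integral_const_mul, hmean]
    · field_simp
      linarith
    · exact integrable_sphereUniform (by fun_prop)
    · exact integrable_sphereUniform (by fun_prop)
    · exact integrable_sphereUniform (by fun_prop)
    · exact integrable_sphereUniform (by fun_prop)
  rw [e]
  have hconst : f w - f x - (2 * M + L * D) * δ
      = ∫ _ : UnitSphere p, (f w - f x - (2 * M + L * D) * δ) ∂sphereUniform p := by simp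
  rw [hconst]
  refine integral_mono (integrable_const _) (integrable_sphereUniform (by fun_prop)) fun s => ?_
  have hs : ‖δ • (s : Vec p)‖ = δ := by simp [norm_smul, abs_of_pos hδ]
  have h1 := sub_le_fderiv_perturbed hc hfd hM w x (δ • (s : Vec p))
  have h2 := abs_taylor_remainder_le hc hfd hL w (δ • (s : Vec p))
  rw [hs] at h1 h2
  have h3 : |inner ℝ (s : Vec p) (w - x)| ≤ D := by
    have := abs_real_inner_le_norm (s : Vec p) (w - x)
    simp only [norm_eq_of_mem_sphere, one_mul] at this
    exact this.trans hD
  have h4 := mul_le_mul h3 h2 (abs_nonneg _) ((norm_nonneg _).trans hD)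
  rw [← abs_mul] at h4
  have h5 : -(L * D * δ) ≤ 1 / δ * (inner ℝ (s : Vec p) (w - x) * (f (w + δ • (s : Vec p)) - f w
      - fderiv ℝ f (w + δ • (s : Vec p)) (δ • (s : Vec p)))) := by
    rw [one_div, ← div_eq_inv_mul, le_div_iff₀ hδ]
    linarith [(abs_le.1 h4).1]
  simp only
  linarith

end Smoothing

/-! ### Deterministic estimates for one step of the controller. -/

namespace Problem

variable {p q r : ℕ} {P : Problem p q r}

theorem Regular.mono {D G τ : ℝ} {L M MΦ L' M' MΦ' : ℕ → ℝ} (hP : P.Regular D G τ L M MΦ)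
    (hL : ∀ k, L k ≤ L' k) (hM : ∀ k, M k ≤ M' k) (hMΦ : ∀ k, MΦ k ≤ MΦ' k) :
    P.Regular D G τ L' M' MΦ' where
  h_diff := hP.h_diff
  Φ_diff := hP.Φ_diff
  U_closed := hP.U_closed
  U_convex := hP.U_convex
  U_diam := hP.U_diam
  reduced_convex := hP.reduced_convex
  reduced_diff := hP.reduced_diff
  reduced_smooth k u₁ u₂ := (hP.reduced_smooth k u₁ u₂).trans (by gcongr; exact hL k)
  reduced_lipschitz k u₁ u₂ := (hP.reduced_lipschitz k u₁ u₂).trans (by gcongr; exact hM k)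
  Φ_lipschitz k u y₁ y₂ := (hP.Φ_lipschitz k u y₁ y₂).trans (by gcongr; exact hMΦ k)
  reduced_bounded := hP.reduced_bounded

section Regular

variable {D G τ L M N : ℝ}
  (hP : P.Regular D G τ (fun _ => L) (fun _ => M) (fun _ => N))

include hP

theorem Regular.norm_fderiv_reduced_le (hM : 0 ≤ M) (k : ℕ) (u : Vec p) :
    ‖fderiv ℝ (P.reduced k) u‖ ≤ M :=
  norm_fderiv_le_of_lip' ℝ hM (Filter.Eventually.of_forall fun x => hP.reduced_lipschitz k x u)

theorem Regular.norm_fderiv_reduced_sub_le (k : ℕ) (u₁ u₂ : Vec p) :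
    ‖fderiv ℝ (P.reduced k) u₁ - fderiv ℝ (P.reduced k) u₂‖ ≤ L * ‖u₁ - u₂‖ := by
  rw [← toDual_gradient, ← toDual_gradient, ← map_sub, LinearIsometryEquiv.norm_map]
  exact hP.reduced_smooth k u₁ u₂

theorem Regular.contDiff_reduced (k : ℕ) : ContDiff ℝ 1 (P.reduced k) := by
  rw [contDiff_one_iff_fderiv]
  refine ⟨hP.reduced_diff k, ?_⟩
  refine (LipschitzWith.of_dist_le_mul (K := L.toNNReal) fun x y => ?_).continuous
  rw [dist_eq_norm, dist_eq_norm]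
  refine (hP.norm_fderiv_reduced_sub_le k x y).trans ?_
  gcongr
  exact Real.le_coe_toNNReal L

theorem Regular.norm_gradient_output_le (hN : 0 ≤ N) (k : ℕ) (u : Vec p) (y : Vec q) :
    ‖gradient (P.Φ k u) y‖ ≤ N := by
  rw [gradient, LinearIsometryEquiv.norm_map]
  exact norm_fderiv_le_of_lip' ℝ hN (Filter.Eventually.of_forall fun x => hP.Φ_lipschitz k u x y)

/-- Writing partial gradients through the joint derivative serves the chain rule, and also
measurability when the other argument varies with the realisation. -/
theorem Regular.gradient_input_eq (k : ℕ) (u : Vec p) (y : Vec q) :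
    gradient (fun u' => P.Φ k u' y) u = (InnerProductSpace.toDual ℝ (Vec p)).symm
      ((fderiv ℝ (fun x : Vec p × Vec q => P.Φ k x.1 x.2) (u, y)).comp
        (ContinuousLinearMap.inl ℝ (Vec p) (Vec q))) := by
  rw [gradient]
  congr 1
  have h := (hP.Φ_diff k (u, y)).hasFDerivAt
  have h2 : HasFDerivAt (fun u' : Vec p => (u', y)) (ContinuousLinearMap.inl ℝ (Vec p) (Vec q)) u :=
    hasFDerivAt_prodMk_left u y
  exact (h.comp u h2).fderiv

theorem Regular.gradient_output_eq (k : ℕ) (u : Vec p) (y : Vec q) :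
    gradient (P.Φ k u) y = (InnerProductSpace.toDual ℝ (Vec q)).symm
      ((fderiv ℝ (fun x : Vec p × Vec q => P.Φ k x.1 x.2) (u, y)).comp
        (ContinuousLinearMap.inr ℝ (Vec p) (Vec q))) := by
  rw [gradient]
  congr 1
  have h := (hP.Φ_diff k (u, y)).hasFDerivAt
  have h2 : HasFDerivAt (fun y' : Vec q => (u, y')) (ContinuousLinearMap.inr ℝ (Vec p) (Vec q)) y :=
    hasFDerivAt_prodMk_right u y
  exact (h.comp y h2).fderiv

/-- With the exact sensitivity, the chain rule makes this direction the gradient of the reduced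
objective; it is affine in `Ĥ`, which isolates the error. -/
theorem Regular.modelBasedDir_eq (k : ℕ) (Ĥ : Vec p →L[ℝ] Vec q) (u : Vec p) :
    P.modelBasedDir k Ĥ u (P.h u (P.d k)) = gradient (P.reduced k) u
      + ContinuousLinearMap.adjoint (Ĥ - P.sensitivity k u)
          (gradient (P.Φ k u) (P.h u (P.d k))) := by
  have hred : fderiv ℝ (P.reduced k) u
      = (fderiv ℝ (fun x : Vec p × Vec q => P.Φ k x.1 x.2) (u, P.h u (P.d k))).comp
        ((ContinuousLinearMap.id ℝ (Vec p)).prod (P.sensitivity k u)) := by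
    have h := (hP.Φ_diff k (u, P.h u (P.d k))).hasFDerivAt
    have h2 := (hasFDerivAt_id (𝕜 := ℝ) u).prodMk (hP.h_diff (P.d k) u).hasFDerivAt
    exact (h.comp u h2).fderiv
  refine ext_inner_right ℝ fun z => ?_
  have hz : ((z, P.sensitivity k u z) : Vec p × Vec q) = (z, 0) + (0, P.sensitivity k u z) := by
    simp
  rw [modelBasedDir, hP.gradient_input_eq, hP.gradient_output_eq, inner_add_left, inner_add_left,
    ContinuousLinearMap.adjoint_inner_left, ContinuousLinearMap.adjoint_inner_left,
    inner_gradient_left, hred]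
  simp only [InnerProductSpace.toDual_symm_apply, ContinuousLinearMap.comp_apply,
    ContinuousLinearMap.inl_apply, ContinuousLinearMap.inr_apply, ContinuousLinearMap.prod_apply,
    ContinuousLinearMap.id_apply, hz, _root_.sub_apply]
  rw [← map_add, ← map_add]
  congr 1
  simp

theorem Regular.norm_modelBasedDir_le (hM : 0 ≤ M) (hN : 0 ≤ N) (k : ℕ) (Ĥ : Vec p →L[ℝ] Vec q)
    (u : Vec p) :
    ‖P.modelBasedDir k Ĥ u (P.h u (P.d k))‖ ≤ M + ‖Ĥ - P.sensitivity k u‖ * N := by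
  rw [hP.modelBasedDir_eq]
  refine (norm_add_le _ _).trans (add_le_add ?_ ?_)
  · rw [gradient, LinearIsometryEquiv.norm_map]
    exact hP.norm_fderiv_reduced_le hM k u
  · refine (ContinuousLinearMap.le_opNorm _ _).trans ?_
    rw [LinearIsometryEquiv.norm_map]
    gcongr
    exact hP.norm_gradient_output_le hN _ _ _

theorem Regular.le_inner_modelBasedDir (hN : 0 ≤ N) (k : ℕ)
    (Ĥ : Vec p →L[ℝ] Vec q) (u z : Vec p) :
    fderiv ℝ (P.reduced k) u z - ‖Ĥ - P.sensitivity k u‖ * N * ‖z‖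
      ≤ inner ℝ (P.modelBasedDir k Ĥ u (P.h u (P.d k))) z := by
  rw [hP.modelBasedDir_eq, inner_add_left, inner_gradient_left]
  have h1 := abs_real_inner_le_norm (ContinuousLinearMap.adjoint (Ĥ - P.sensitivity k u)
          (gradient (P.Φ k u) (P.h u (P.d k)))) z
  have h2 : ‖ContinuousLinearMap.adjoint (Ĥ - P.sensitivity k u)
          (gradient (P.Φ k u) (P.h u (P.d k)))‖ ≤ ‖Ĥ - P.sensitivity k u‖ * N := by
    refine (ContinuousLinearMap.le_opNorm _ _).trans ?_
    rw [LinearIsometryEquiv.norm_map]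
    gcongr
    exact hP.norm_gradient_output_le hN _ _ _
  have h3 := h1.trans (mul_le_mul_of_nonneg_right h2 (norm_nonneg z))
  linarith [(abs_le.1 h3).1]

theorem Regular.measurable_modelBasedDir (k : ℕ) {Ω : Type*} [MeasurableSpace Ω]
    {Ĥ : Ω → Vec p →L[ℝ] Vec q} {u : Ω → Vec p} {y : Ω → Vec q} (hĤ : Measurable Ĥ)
    (hu : Measurable u) (hy : Measurable y) :
    Measurable fun ω => P.modelBasedDir k (Ĥ ω) (u ω) (y ω) := by
  simp only [modelBasedDir]
  have hF : Measurable fun ω =>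
      fderiv ℝ (fun x : Vec p × Vec q => P.Φ k x.1 x.2) (u ω, y ω) :=
    (measurable_fderiv ℝ _).comp (hu.prodMk hy)
  refine Measurable.add ?_ ?_
  · simp only [hP.gradient_input_eq]
    refine (LinearIsometryEquiv.continuous _).measurable.comp ?_
    have hc : Continuous fun A : Vec p × Vec q →L[ℝ] ℝ =>
        A.comp (ContinuousLinearMap.inl ℝ (Vec p) (Vec q)) := by fun_prop
    exact hc.measurable.comp hF
  · have hg : Measurable fun ω => gradient (P.Φ k (u ω)) (y ω) := by
      simp only [hP.gradient_output_eq]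
      refine (LinearIsometryEquiv.continuous _).measurable.comp ?_
      have hc : Continuous fun A : Vec p × Vec q →L[ℝ] ℝ =>
          A.comp (ContinuousLinearMap.inr ℝ (Vec p) (Vec q)) := by fun_prop
      exact hc.measurable.comp hF
    have hA : Measurable fun ω => ContinuousLinearMap.adjoint (Ĥ ω) :=
      (LinearIsometryEquiv.continuous ContinuousLinearMap.adjoint).measurable.comp hĤ
    have hc : Continuous fun x : (Vec q →L[ℝ] Vec p) × Vec q => x.1 x.2 :=
      isBoundedBilinearMap_apply.continuous
    exact hc.measurable.comp (hA.prodMk hg)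

variable {η δ : ℝ} {α : ℕ → ℝ} {w₀ : Vec p}

/-- Only inputs with index below k enter the state at time k. The σ-algebra is left free so that `ℱ
j` can be inserted with k = j + 1; the state is then independent of the direction drawn at that
time. -/
theorem Regular.measurable_state (hne : P.U.Nonempty) {Ω : Type*} {mΩ : MeasurableSpace Ω}
    {c₀ : Ω → ℝ}
    {Ĥ : ℕ → Ω → Vec p →L[ℝ] Vec q} {v : ℕ → Ω → Vec p} (hc₀ : Measurable c₀) (k : ℕ)
    (hĤ : ∀ j < k, Measurable (Ĥ j)) (hv : ∀ j < k, Measurable (v j)) :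
    Measurable fun ω => P.state η δ α w₀ (c₀ ω) (fun j => Ĥ j ω) (fun j => v j ω) k := by
  induction k with
  | zero => exact measurable_const.prodMk hc₀
  | succ k ih =>
    have ih := ih (fun j hj => hĤ j (by omega)) fun j hj => hv j (by omega)
    have hvk := hv k (by omega)
    have hHk := hĤ k (by omega)
    have hu : Measurable fun ω =>
        (P.state η δ α w₀ (c₀ ω) (fun j => Ĥ j ω) (fun j => v j ω) k).1 + δ • v k ω :=
      ih.fst.add (hvk.const_smul δ)
    have hy : Measurable fun ω => P.h ((P.state η δ α w₀ (c₀ ω) (fun j => Ĥ j ω)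
        (fun j => v j ω) k).1 + δ • v k ω) (P.d k) :=
      (hP.h_diff (P.d k)).continuous.measurable.comp hu
    have hf := (hP.reduced_diff k).continuous.measurable.comp hu
    have hφ₁ := hP.measurable_modelBasedDir k hHk hu hy
    refine Measurable.prodMk ?_ hf
    refine (continuous_proj hne hP.U_closed hP.U_convex).measurable.comp ?_
    have hφ₂ := ((hf.sub ih.snd).const_mul ((p : ℝ) / δ)).smul hvk
    exact ih.fst.sub (((hφ₁.const_smul (α k)).add (hφ₂.const_smul (1 - α k))).const_smul η)

theorem Regular.measurable_sensError (hne : P.U.Nonempty) {Ω : Type*} [MeasurableSpace Ω]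
    {c₀ : Ω → ℝ} {Ĥ : ℕ → Ω → Vec p →L[ℝ] Vec q} {v : ℕ → Ω → Vec p} (hc₀ : Measurable c₀) (k : ℕ)
    (hĤ : ∀ j, Measurable (Ĥ j)) (hv : ∀ j, Measurable (v j)) :
    Measurable fun ω => P.sensError η δ α w₀ (c₀ ω) (fun j => Ĥ j ω) (fun j => v j ω) k := by
  have hs := hP.measurable_state (η := η) (δ := δ) (α := α) (w₀ := w₀) hne hc₀ k (fun j _ => hĤ j)
    fun j _ => hv j
  have hu := hs.fst.add ((hv k).const_smul δ)
  have hd : Measurable fun ω => P.sensitivity k (P.candidate η δ α w₀ (c₀ ω) (fun j => Ĥ j ω)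
      (fun j => v j ω) k + δ • v k ω) := (measurable_fderiv ℝ _).comp hu
  exact ((hĤ k).sub hd).norm

theorem Regular.candidate_mem (hw₀ : w₀ ∈ P.U) (c₀ : ℝ) (Ĥ : ℕ → Vec p →L[ℝ] Vec q)
    (v : ℕ → Vec p) (k : ℕ) : P.candidate η δ α w₀ c₀ Ĥ v k ∈ P.U := by
  cases k with
  | zero => exact hw₀
  | succ k => exact proj_mem ⟨_, hw₀⟩ hP.U_closed hP.U_convex _

/-- This is where δ ≤ τ matters: the perturbation is τ times the shorter vector (δ/τ)s. -/
theorem Regular.abs_reduced_add_le (hτ : 0 < τ) (hδ : 0 ≤ δ) (hδτ : δ ≤ τ) (k : ℕ) {w s : Vec p}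
    (hw : w ∈ P.U) (hs : ‖s‖ ≤ 1) : |P.reduced k (w + δ • s)| ≤ G := by
  have h := hP.reduced_bounded k w hw ((δ / τ) • s) (by
    rw [norm_smul, Real.norm_eq_abs, abs_of_nonneg (by positivity)]
    have : δ / τ ≤ 1 := by rwa [div_le_one hτ]
    exact mul_le_one₀ this (norm_nonneg _) hs)
  rwa [smul_smul, mul_div_cancel₀ _ hτ.ne'] at h

theorem Regular.abs_reduced_le (k : ℕ) {w : Vec p} (hw : w ∈ P.U) : |P.reduced k w| ≤ G := by
  simpa using hP.reduced_bounded k w hw 0 (by simp)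

/-- Descent inequality for one step of the controller. -/
theorem Regular.norm_sq_state_succ_sub_le (hM : 0 ≤ M) (hN : 0 ≤ N) (hη : 0 ≤ η) (hτ : 0 < τ)
    (hδ : 0 < δ) (hδτ : δ ≤ τ) (hw₀ : w₀ ∈ P.U) {c₀ : ℝ} {Ĥ : ℕ → Vec p →L[ℝ] Vec q}
    {v : ℕ → Vec p} {k : ℕ} (hα : 0 ≤ α k ∧ α k ≤ 1) (hv : ‖v k‖ = 1) {w : Vec p} {c ε : ℝ}
    (hs : P.state η δ α w₀ c₀ Ĥ v k = (w, c)) (hc : |c| ≤ G)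
    (hε : P.sensError η δ α w₀ c₀ Ĥ v k = ε) {εb : ℝ} (hεb : ε ≤ εb) {x : Vec p} (hx : x ∈ P.U) :
    ‖P.candidate η δ α w₀ c₀ Ĥ v (k + 1) - x‖ ^ 2 ≤ ‖w - x‖ ^ 2
      - 2 * η * (α k * (P.reduced k w - P.reduced k x - 2 * M * δ - ε * N * D)
        + (1 - α k) * ((p : ℝ) / δ * (P.reduced k (w + δ • v k) - c) * inner ℝ (v k) (w - x)))
      + η ^ 2 * (M + εb * N + (p : ℝ) / δ * (2 * G)) ^ 2 := by
  have hw : w ∈ P.U := by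
    have := hP.candidate_mem (η := η) (δ := δ) (α := α) hw₀ c₀ Ĥ v k
    rwa [candidate, hs] at this
  have hε' : ‖Ĥ k - P.sensitivity k (w + δ • v k)‖ = ε := by
    rw [← hε, sensError, candidate, hs]
  have hε0 : 0 ≤ ε := hε' ▸ norm_nonneg _
  set φ₁ := P.modelBasedDir k (Ĥ k) (w + δ • v k) (P.h (w + δ • v k) (P.d k)) with hφ₁
  set φ₂ := ((p : ℝ) / δ * (P.reduced k (w + δ • v k) - c)) • v k with hφ₂
  have hstep : P.candidate η δ α w₀ c₀ Ĥ v (k + 1)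
      = proj P.U (w - η • (α k • φ₁ + (1 - α k) • φ₂)) := by
    simp only [candidate, state, hs, hφ₁, hφ₂, reduced]
  set φ := α k • φ₁ + (1 - α k) • φ₂ with hφ
  have hwx : ‖w - x‖ ≤ D := hP.U_diam w hw x hx
  have hn1 : ‖φ₁‖ ≤ M + εb * N := by
    refine (hP.norm_modelBasedDir_le hM hN k _ _).trans ?_
    rw [hε']
    gcongr
  have hG : 0 ≤ G := (abs_nonneg c).trans hc
  -- Both the new and the stored objective value lie in [-G, G], so their difference is at most 2G.
  have hn2 : ‖φ₂‖ ≤ (p : ℝ) / δ * (2 * G) := by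
    rw [hφ₂, norm_smul, hv, mul_one, norm_mul, Real.norm_of_nonneg (by positivity)]
    gcongr
    refine (norm_sub_le _ _).trans ?_
    have := hP.abs_reduced_add_le hτ hδ.le hδτ k hw hv.le
    rw [Real.norm_eq_abs, Real.norm_eq_abs]
    linarith
  have hn : ‖φ‖ ≤ M + εb * N + (p : ℝ) / δ * (2 * G) := by
    refine (norm_add_le _ _).trans (add_le_add ?_ ?_)
    · rw [norm_smul, Real.norm_of_nonneg hα.1]
      exact (mul_le_of_le_one_left (norm_nonneg _) hα.2).trans hn1
    · rw [norm_smul, Real.norm_of_nonneg (by linarith [hα.2])]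
      exact (mul_le_of_le_one_left (norm_nonneg _) (by linarith [hα.1])).trans hn2
  have hi1 : P.reduced k w - P.reduced k x - 2 * M * δ - ε * N * D ≤ inner ℝ φ₁ (w - x) := by
    have h1 := hP.le_inner_modelBasedDir hN k (Ĥ k) (w + δ • v k) (w - x)
    have h2 := sub_le_fderiv_perturbed (hP.reduced_convex k) (hP.reduced_diff k)
      (hP.norm_fderiv_reduced_le hM k) w x (δ • v k)
    rw [norm_smul, hv, mul_one, Real.norm_of_nonneg hδ.le] at h2
    rw [hε'] at h1
    have h3 : ε * N * ‖w - x‖ ≤ ε * N * D := by gcongr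
    linarith
  have hi : α k * (P.reduced k w - P.reduced k x - 2 * M * δ - ε * N * D)
        + (1 - α k) * ((p : ℝ) / δ * (P.reduced k (w + δ • v k) - c) * inner ℝ (v k) (w - x))
      ≤ inner ℝ φ (w - x) := by
    rw [hφ, inner_add_left, inner_smul_left, inner_smul_left, hφ₂, inner_smul_left]
    have := mul_le_mul_of_nonneg_left hi1 hα.1
    simpa using this
  rw [hstep]
  have h1 := norm_proj_sub_le hP.U_closed hP.U_convex (w - η • φ) hx
  have h2 : ‖w - η • φ - x‖ ^ 2 = ‖w - x‖ ^ 2 - 2 * η * inner ℝ φ (w - x) + η ^ 2 * ‖φ‖ ^ 2 := by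
    have : w - η • φ - x = (w - x) - η • φ := by abel
    rw [this, norm_sub_sq_real, inner_smul_right, norm_smul, mul_pow, Real.norm_of_nonneg hη,
      real_inner_comm]
    ring
  have h3 : ‖proj P.U (w - η • φ) - x‖ ^ 2 ≤ ‖w - η • φ - x‖ ^ 2 := by gcongr
  have h4 : ‖φ‖ ^ 2 ≤ (M + εb * N + (p : ℝ) / δ * (2 * G)) ^ 2 := by gcongr
  have h5 := mul_le_mul_of_nonneg_left hi (by positivity : 0 ≤ 2 * η)
  have h6 := mul_le_mul_of_nonneg_left h4 (by positivity : 0 ≤ η ^ 2)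
  linarith

end Regular

end Problem

/-! ### Averaging over a fresh direction and expected descent. -/

theorem integral_comp_le_of_indepFun {Ω A S : Type*} [MeasurableSpace Ω] [MeasurableSpace A]
    [MeasurableSpace S] {μ : Measure Ω} [IsProbabilityMeasure μ] {X : Ω → A} {V : Ω → S}
    (hX : Measurable X) (hV : Measurable V) (hXV : X ⟂ᵢ[μ] V) {F : A × S → ℝ} {ψ : A → ℝ}
    (hF : Measurable F) (hFi : Integrable (fun ω => F (X ω, V ω)) μ)
    (hψi : Integrable (fun ω => ψ (X ω)) μ)
    (hle : ∀ ω, ψ (X ω) ≤ ∫ s, F (X ω, s) ∂μ.map V) :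
    ∫ ω, ψ (X ω) ∂μ ≤ ∫ ω, F (X ω, V ω) ∂μ := by
  -- Independence makes the joint law a product, so Fubini allows X to be frozen while V is
  -- averaged; this replaces conditional expectations.
  have hprod := (indepFun_iff_map_prod_eq_prod_map_map hX.aemeasurable hV.aemeasurable).1 hXV
  have hFi' : Integrable F ((μ.map X).prod (μ.map V)) := by
    rw [← hprod, integrable_map_measure hF.aestronglyMeasurable (hX.prodMk hV).aemeasurable]
    exact hFi
  have : IsProbabilityMeasure (μ.map V) := Measure.isProbabilityMeasure_map hV.aemeasurable
  have e : ∫ ω, F (X ω, V ω) ∂μ = ∫ ω, ∫ s, F (X ω, s) ∂μ.map V ∂μ := by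
    rw [← integral_map (φ := fun ω => (X ω, V ω)) (hX.prodMk hV).aemeasurable
      hF.aestronglyMeasurable, hprod, integral_prod _ hFi', integral_map hX.aemeasurable]
    exact hF.stronglyMeasurable.integral_prod_right'.aestronglyMeasurable
  rw [e]
  refine integral_mono hψi ?_ hle
  have := hFi'.integral_prod_left
  rwa [integrable_map_measure this.aestronglyMeasurable hX.aemeasurable] at this

namespace Problem

variable {p q r : ℕ} {P : Problem p q r} {D G τ L M N : ℝ}
  {Ω : Type*} [m : MeasurableSpace Ω] {μ : Measure Ω}
  {ℱ : Filtration ℕ m} {v : ℕ → Ω → UnitSphere p} {δ : ℝ}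

theorem Regular.sub_le_integral_zeroth_order [IsProbabilityMeasure μ]
    (hP : P.Regular D G τ (fun _ => L) (fun _ => M) (fun _ => N))
    (hv : IsExploration μ ℱ v) (hM : 0 ≤ M) (hτ : 0 < τ) (hδ : 0 < δ) (hδτ : δ ≤ τ) {j : ℕ}
    {S : Ω → Vec p × ℝ} (hS : Measurable[ℱ j] S) (hSU : ∀ ω, (S ω).1 ∈ P.U)
    (hSG : ∀ ω, |(S ω).2| ≤ G) {x : Vec p} (hx : x ∈ P.U) :
    Integrable (fun ω => (p : ℝ) / δ * (P.reduced (j + 1) ((S ω).1 + δ • (v (j + 1) ω : Vec p))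
        - (S ω).2) * inner ℝ (v (j + 1) ω : Vec p) ((S ω).1 - x)) μ ∧
    (∫ ω, P.reduced (j + 1) (S ω).1 ∂μ) - P.reduced (j + 1) x - (2 * M + L * D) * δ ≤
      ∫ ω, (p : ℝ) / δ * (P.reduced (j + 1) ((S ω).1 + δ • (v (j + 1) ω : Vec p)) - (S ω).2)
        * inner ℝ (v (j + 1) ω : Vec p) ((S ω).1 - x) ∂μ := by
  have hSm : Measurable S := hS.mono (ℱ.le j) le_rfl
  have hvm : Measurable (v (j + 1)) := (hv.adapted (j + 1)).mono (ℱ.le _) le_rfl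
  have hind : S ⟂ᵢ[μ] v (j + 1) := by
    rw [IndepFun_iff_Indep]
    exact indep_of_indep_of_le_left (hv.indep j) hS.comap_le
  have hlaw := hv.law (j + 1)
  have : IsProbabilityMeasure (sphereUniform p) := by
    rw [← hlaw]; exact Measure.isProbabilityMeasure_map hvm.aemeasurable
  have hfc : Continuous (P.reduced (j + 1)) := (hP.reduced_diff (j + 1)).continuous
  set F : (Vec p × ℝ) × UnitSphere p → ℝ := fun y =>
    (p : ℝ) / δ * (P.reduced (j + 1) (y.1.1 + δ • (y.2 : Vec p)) - y.1.2)
      * inner ℝ (y.2 : Vec p) (y.1.1 - x) with hF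
  have hFm : Measurable F := by
    have hc : Continuous F := by
      have : Continuous fun y : (Vec p × ℝ) × UnitSphere p =>
          P.reduced (j + 1) (y.1.1 + δ • (y.2 : Vec p)) := hfc.comp (by fun_prop)
      simp only [hF]
      fun_prop
    exact hc.measurable
  have hFi : Integrable (fun ω => F (S ω, v (j + 1) ω)) μ := by
    refine Integrable.of_bound (hFm.comp (hSm.prodMk hvm)).aestronglyMeasurable
      ((p : ℝ) / δ * (2 * G) * D) (Filter.Eventually.of_forall fun ω => ?_)
    have h1 := hP.abs_reduced_add_le hτ hδ.le hδτ (j + 1) (hSU ω)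
      (s := (v (j + 1) ω : Vec p)) (by simp)
    have h2 := hSG ω
    have h3 : |inner ℝ (v (j + 1) ω : Vec p) ((S ω).1 - x)| ≤ D := by
      refine (abs_real_inner_le_norm _ _).trans ?_
      simpa using hP.U_diam _ (hSU ω) x hx
    have hG : 0 ≤ G := (abs_nonneg _).trans h2
    simp only [hF]
    rw [norm_mul, norm_mul, Real.norm_of_nonneg (by positivity), Real.norm_eq_abs, Real.norm_eq_abs]
    gcongr
    refine (abs_sub _ _).trans ?_
    linarith
  have hri : Integrable (fun ω => P.reduced (j + 1) (S ω).1) μ :=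
    Integrable.of_bound (hfc.measurable.comp hSm.fst).aestronglyMeasurable G
      (Filter.Eventually.of_forall fun ω => hP.abs_reduced_le (j + 1) (hSU ω))
  have hri' : Integrable (fun ω => P.reduced (j + 1) (S ω).1 - P.reduced (j + 1) x) μ :=
    hri.sub (integrable_const _)
  refine ⟨hFi, ?_⟩
  have key := integral_comp_le_of_indepFun hSm hvm hind (F := F)
    (ψ := fun y => P.reduced (j + 1) y.1 - P.reduced (j + 1) x - (2 * M + L * D) * δ) hFm
    hFi
    (hri'.sub (integrable_const _)) (fun ω => by
      rw [hlaw]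
      exact GrayBox.sub_le_integral_zeroth_order (hP.reduced_convex (j + 1))
        (hP.contDiff_reduced (j + 1)) (hP.norm_fderiv_reduced_sub_le (j + 1))
        (hP.norm_fderiv_reduced_le hM (j + 1)) hδ (hP.U_diam _ (hSU ω) x hx) (S ω).2)
  rw [integral_sub hri' (integrable_const _), integral_sub hri (integrable_const _)] at key
  simpa using key

variable {η : ℝ} {α : ℕ → ℝ} {w₀ : Vec p} {c₀ : Ω → ℝ} {Ĥ : ℕ → Ω → Vec p →L[ℝ] Vec q}
  {w : ℕ → Ω → Vec p} {e : ℕ → Ω → ℝ}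

theorem Regular.measurable_candidate
    (hP : P.Regular D G τ (fun _ => L) (fun _ => M) (fun _ => N)) (hv : IsExploration μ ℱ v)
    (hĤ : ∀ k, Measurable[ℱ k] (Ĥ k)) (hw₀ : w₀ ∈ P.U) (hc₀ : Measurable[ℱ 0] c₀)
    (hw : ∀ k ω, w k ω = P.candidate η δ α w₀ (c₀ ω) (fun j => Ĥ j ω) (fun j => (v j ω : Vec p)) k)
    (k : ℕ) : Measurable (w k) := by
  have h := (hP.measurable_state (η := η) (δ := δ) (α := α) (w₀ := w₀) ⟨_, hw₀⟩
    (hc₀.mono (ℱ.le 0) le_rfl) k (fun j _ => (hĤ j).mono (ℱ.le j) le_rfl)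
    (fun j _ => measurable_subtype_coe.comp ((hv.adapted j).mono (ℱ.le j) le_rfl))).fst
  have e : w k = fun ω => (P.state η δ α w₀ (c₀ ω) (fun j => Ĥ j ω)
    (fun j => (v j ω : Vec p)) k).1 := funext fun ω => hw k ω
  rw [e]
  exact h

theorem Regular.integrable_reduced_candidate [IsProbabilityMeasure μ]
    (hP : P.Regular D G τ (fun _ => L) (fun _ => M) (fun _ => N)) (hv : IsExploration μ ℱ v)
    (hĤ : ∀ k, Measurable[ℱ k] (Ĥ k)) (hw₀ : w₀ ∈ P.U) (hc₀ : Measurable[ℱ 0] c₀)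
    (hw : ∀ k ω, w k ω = P.candidate η δ α w₀ (c₀ ω) (fun j => Ĥ j ω) (fun j => (v j ω : Vec p)) k)
    (i k : ℕ) : Integrable (fun ω => P.reduced i (w k ω)) μ := by
  refine Integrable.of_bound ((hP.reduced_diff i).continuous.measurable.comp
    (hP.measurable_candidate hv hĤ hw₀ hc₀ hw k)).aestronglyMeasurable G
    (Filter.Eventually.of_forall fun ω => ?_)
  exact hP.abs_reduced_le i (hw k ω ▸ hP.candidate_mem hw₀ _ _ _ _)

theorem Regular.integrable_sensError [IsProbabilityMeasure μ]
    (hP : P.Regular D G τ (fun _ => L) (fun _ => M) (fun _ => N)) (hv : IsExploration μ ℱ v)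
    (hĤ : ∀ k, Measurable[ℱ k] (Ĥ k)) (hw₀ : w₀ ∈ P.U) (hc₀ : Measurable[ℱ 0] c₀)
    (he : ∀ k ω, e k ω = P.sensError η δ α w₀ (c₀ ω) (fun j => Ĥ j ω) (fun j => (v j ω : Vec p)) k)
    {k : ℕ} {εb : ℝ} (hε : ∀ᵐ ω ∂μ, e k ω ≤ εb) : Integrable (e k) μ := by
  have h := hP.measurable_sensError (η := η) (δ := δ) (α := α) (w₀ := w₀) ⟨_, hw₀⟩
    (hc₀.mono (ℱ.le 0) le_rfl) k (fun j => (hĤ j).mono (ℱ.le j) le_rfl)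
    (fun j => measurable_subtype_coe.comp ((hv.adapted j).mono (ℱ.le j) le_rfl))
  have hem : e k = fun ω => P.sensError η δ α w₀ (c₀ ω) (fun j => Ĥ j ω)
    (fun j => (v j ω : Vec p)) k := funext fun ω => he k ω
  refine Integrable.of_bound (C := εb) (by rw [hem]; exact h.aestronglyMeasurable) ?_
  filter_upwards [hε] with ω hω
  rwa [Real.norm_of_nonneg (by rw [he]; exact norm_nonneg _)]

/-- Expected descent over one step of the controller. -/
theorem Regular.integral_norm_sq_candidate_succ_sub_le [IsProbabilityMeasure μ]
    (hP : P.Regular D G τ (fun _ => L) (fun _ => M) (fun _ => N)) (hv : IsExploration μ ℱ v)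
    (hL : 0 ≤ L) (hD : 0 ≤ D) (hM : 0 ≤ M) (hN : 0 ≤ N) (hη : 0 ≤ η) (hτ : 0 < τ) (hδ : 0 < δ)
    (hδτ : δ ≤ τ)
    (hĤ : ∀ k, Measurable[ℱ k] (Ĥ k)) (hα : ∀ k, 0 ≤ α k ∧ α k ≤ 1) (hw₀ : w₀ ∈ P.U)
    (hc₀ : Measurable[ℱ 0] c₀)
    (hw : ∀ k ω, w k ω = P.candidate η δ α w₀ (c₀ ω) (fun j => Ĥ j ω) (fun j => (v j ω : Vec p)) k)
    (he : ∀ k ω, e k ω = P.sensError η δ α w₀ (c₀ ω) (fun j => Ĥ j ω) (fun j => (v j ω : Vec p)) k)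
    (j : ℕ) {εb : ℝ} (hε : ∀ᵐ ω ∂μ, e (j + 1) ω ≤ εb) {x : Vec p} (hx : x ∈ P.U) :
    ∫ ω, ‖w (j + 2) ω - x‖ ^ 2 ∂μ ≤ ∫ ω, ‖w (j + 1) ω - x‖ ^ 2 ∂μ
      - 2 * η * ((∫ ω, P.reduced (j + 1) (w (j + 1) ω) ∂μ) - P.reduced (j + 1) x
        - (2 * M + L * D) * δ - N * D * (α (j + 1) * ∫ ω, e (j + 1) ω ∂μ))
      + η ^ 2 * (M + εb * N + (p : ℝ) / δ * (2 * G)) ^ 2 := by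
  set S : Ω → Vec p × ℝ := fun ω => P.state η δ α w₀ (c₀ ω) (fun j => Ĥ j ω)
    (fun j => (v j ω : Vec p)) (j + 1)
  have hwm := hP.measurable_candidate hv hĤ hw₀ hc₀ hw
  have hwU : ∀ k ω, w k ω ∈ P.U := fun k ω => hw k ω ▸ hP.candidate_mem hw₀ _ _ _ _
  have hwS : ∀ ω, w (j + 1) ω = (S ω).1 := fun ω => hw (j + 1) ω
  have hS : Measurable[ℱ j] S := hP.measurable_state (mΩ := ℱ j) ⟨_, hw₀⟩
    (hc₀.mono (ℱ.mono (Nat.zero_le j)) le_rfl) (j + 1)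
    (fun i hi => (hĤ i).mono (ℱ.mono (by omega)) le_rfl)
    (fun i hi => measurable_subtype_coe.comp ((hv.adapted i).mono (ℱ.mono (by omega)) le_rfl))
  -- Working at time j + 1 guarantees that the stored value is a genuine evaluation at time j, not
  -- the arbitrary initial datum, which need not be bounded.
  have hSG : ∀ ω, |(S ω).2| ≤ G := fun ω =>
    hP.abs_reduced_add_le hτ hδ.le hδτ j (by have := hwU j ω; rwa [hw] at this) (s := (v j ω : Vec p)) (by simp)
  obtain ⟨hZi, hZ⟩ := hP.sub_le_integral_zeroth_order hv hM hτ hδ hδτ hS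
    (fun ω => hwS ω ▸ hwU (j + 1) ω) hSG hx
  set Z : Ω → ℝ := fun ω => (p : ℝ) / δ * (P.reduced (j + 1)
    ((S ω).1 + δ • (v (j + 1) ω : Vec p)) - (S ω).2) * inner ℝ (v (j + 1) ω : Vec p) ((S ω).1 - x)
    with hZdef
  have hei := hP.integrable_sensError hv hĤ hw₀ hc₀ he hε
  have hri := hP.integrable_reduced_candidate hv hĤ hw₀ hc₀ hw (j + 1) (j + 1)
  have hni : ∀ k, Integrable (fun ω => ‖w k ω - x‖ ^ 2) μ := fun k => by
    refine Integrable.of_bound (((hwm k).sub_const x).norm.pow_const 2).aestronglyMeasurable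
      (D ^ 2) (Filter.Eventually.of_forall fun ω => ?_)
    rw [Real.norm_of_nonneg (by positivity)]
    have := hP.U_diam _ (hwU k ω) x hx
    gcongr
  set B := M + εb * N + (p : ℝ) / δ * (2 * G)
  have hpt : ∀ᵐ ω ∂μ, ‖w (j + 2) ω - x‖ ^ 2 ≤ ‖w (j + 1) ω - x‖ ^ 2
      - 2 * η * (α (j + 1) * (P.reduced (j + 1) (w (j + 1) ω) - P.reduced (j + 1) x - 2 * M * δ
          - N * D * e (j + 1) ω) + (1 - α (j + 1)) * Z ω) + η ^ 2 * B ^ 2 := by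
    filter_upwards [hε] with ω hω
    have h := hP.norm_sq_state_succ_sub_le hM hN hη hτ hδ hδτ hw₀ (hα (j + 1))
      (v := fun j => (v j ω : Vec p)) (w := (S ω).1) (c := (S ω).2) (by simp) rfl (hSG ω)
      (he (j + 1) ω).symm hω hx
    rw [hw (j + 2), hwS]
    refine h.trans (le_of_eq ?_)
    simp only [hZdef]
    ring
  have i1 : Integrable (fun ω => P.reduced (j + 1) (w (j + 1) ω) - P.reduced (j + 1) x) μ :=
    hri.sub (integrable_const _)
  have i2 : Integrable (fun ω => P.reduced (j + 1) (w (j + 1) ω) - P.reduced (j + 1) x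
      - 2 * M * δ) μ := i1.sub (integrable_const _)
  have i3 : Integrable (fun ω => α (j + 1) * (P.reduced (j + 1) (w (j + 1) ω)
      - P.reduced (j + 1) x - 2 * M * δ - N * D * e (j + 1) ω)) μ :=
    (i2.sub (hei.const_mul (N * D))).const_mul _
  have i4 := hZi.const_mul (1 - α (j + 1))
  have i5 : Integrable (fun ω => 2 * η * (α (j + 1) * (P.reduced (j + 1) (w (j + 1) ω)
      - P.reduced (j + 1) x - 2 * M * δ - N * D * e (j + 1) ω) + (1 - α (j + 1)) * Z ω)) μ :=
    (i3.add i4).const_mul _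
  have i6 : Integrable (fun ω => ‖w (j + 1) ω - x‖ ^ 2 - 2 * η * (α (j + 1) *
      (P.reduced (j + 1) (w (j + 1) ω) - P.reduced (j + 1) x - 2 * M * δ - N * D * e (j + 1) ω)
        + (1 - α (j + 1)) * Z ω)) μ := (hni (j + 1)).sub i5
  have hmono := integral_mono_ae (hni (j + 2)) (i6.add (integrable_const (η ^ 2 * B ^ 2))) hpt
  rw [integral_add' i6 (integrable_const _), integral_sub (hni (j + 1)) i5, integral_const_mul,
    integral_add i3 i4, integral_const_mul, integral_const_mul,
    integral_sub i2 (hei.const_mul _), integral_sub i1 (integrable_const _),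
    integral_sub hri (integrable_const _), integral_const_mul (N * D)] at hmono
  simp only [integral_const, probReal_univ, one_smul] at hmono
  simp only [← hwS] at hZ
  refine hmono.trans ?_
  set R := ∫ ω, P.reduced (j + 1) (w (j + 1) ω) ∂μ
  set E := ∫ ω, e (j + 1) ω ∂μ
  set IZ := ∫ ω, Z ω ∂μ
  obtain ⟨hα0, hα1⟩ := hα (j + 1)
  -- The bias LDδ arises only in the zeroth-order part. Charging it to the model-based part as well
  -- loses the nonnegative term α L D δ and makes the δ-error independent of α.
  have h1 : R - P.reduced (j + 1) x - (2 * M + L * D) * δ - N * D * (α (j + 1) * E)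
      ≤ α (j + 1) * (R - P.reduced (j + 1) x - 2 * M * δ - N * D * E) + (1 - α (j + 1)) * IZ := by
    have h2 : R - P.reduced (j + 1) x - (2 * M + L * D) * δ ≤ IZ := by
      exact hZ
    have h3 := mul_le_mul_of_nonneg_left h2 (by linarith : 0 ≤ 1 - α (j + 1))
    have h4 : 0 ≤ α (j + 1) * (L * D * δ) := by positivity
    linarith
  have h5 := mul_le_mul_of_nonneg_left h1 (by positivity : 0 ≤ 2 * η)
  linarith

end Problem

/-! ### Telescoping and elementary inequalities behind the rate. -/

theorem two_mul_sum_le_of_descent {a E Δ : ℕ → ℝ} {η β : ℝ} {T : ℕ} (ha : 0 ≤ a T)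
    (h : ∀ k ∈ Finset.Icc 1 T, a k ≤ a (k - 1) + Δ k - 2 * η * E k + β) :
    2 * η * ∑ k ∈ Finset.Icc 1 T, E k ≤ a 0 + ∑ k ∈ Finset.Icc 1 T, Δ k + T * β := by
  have key : ∀ n ≤ T, 2 * η * ∑ k ∈ Finset.Icc 1 n, E k
      ≤ a 0 - a n + ∑ k ∈ Finset.Icc 1 n, Δ k + n * β := by
    intro n
    induction n with
    | zero => simp
    | succ n ih =>
      intro hn
      have h1 := h (n + 1) (Finset.mem_Icc.2 ⟨by omega, hn⟩)
      have h2 := ih (by omega)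
      rw [Finset.sum_Icc_succ_top (by omega), Finset.sum_Icc_succ_top (by omega)]
      rw [Nat.add_sub_cancel] at h1
      push_cast
      linarith
  linarith [key T le_rfl]

/-- The difference of squares factors into a difference of norms and a sum of norms at most 2D. This
is the price of moving the comparator. -/
theorem norm_sub_sq_le_add {E : Type*} [NormedAddCommGroup E] {w x y : E} {D : ℝ}
    (hx : ‖w - x‖ ≤ D) (hy : ‖w - y‖ ≤ D) :
    ‖w - x‖ ^ 2 ≤ ‖w - y‖ ^ 2 + 2 * D * ‖x - y‖ := by
  have h : ‖w - x‖ ≤ ‖w - y‖ + ‖x - y‖ := by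
    have := norm_add_le (w - y) (y - x)
    rwa [sub_add_sub_cancel, norm_sub_rev y x] at this
  nlinarith [norm_nonneg (w - x), norm_nonneg (w - y), norm_nonneg (x - y)]

/-- Each summand is at most the increment of 4t^{3/4}. With x and y the fourth roots of n + 1 and n,
this reduces to 1/x ≤ 4(x³ - y³), where x⁴ - y⁴ = 1. -/
theorem sum_inv_rpow_quarter_le (T : ℕ) :
    ∑ k ∈ Finset.Icc 1 T, 1 / ((k : ℝ) + 1) ^ (1 / 4 : ℝ) ≤ 4 * (T : ℝ) ^ (3 / 4 : ℝ) := by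
  induction T with
  | zero => simp
  | succ n ih =>
    rw [Finset.sum_Icc_succ_top (by omega)]
    push_cast
    have hx : ∀ t : ℝ, 0 ≤ t → (t ^ (1 / 4 : ℝ)) ^ 4 = t ∧
        (t ^ (1 / 4 : ℝ)) ^ 3 = t ^ (3 / 4 : ℝ) := fun t ht => by
      constructor <;> rw [← Real.rpow_natCast, ← Real.rpow_mul ht] <;> norm_num
    obtain ⟨hx4, hx3⟩ := hx ((n : ℝ) + 1) (by positivity)
    obtain ⟨hy4, hy3⟩ := hx (n : ℝ) (by positivity)
    have hmono : ((n : ℝ) + 1) ^ (1 / 4 : ℝ) ≤ ((n : ℝ) + 1 + 1) ^ (1 / 4 : ℝ) := by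
      gcongr; linarith
    have hyx : (n : ℝ) ^ (1 / 4 : ℝ) ≤ ((n : ℝ) + 1) ^ (1 / 4 : ℝ) := by gcongr; linarith
    have hxp : 0 < ((n : ℝ) + 1) ^ (1 / 4 : ℝ) := by positivity
    have hyp : 0 ≤ (n : ℝ) ^ (1 / 4 : ℝ) := by positivity
    have h1 := one_div_le_one_div_of_le hxp hmono
    rw [← hx3]
    rw [← hy3] at ih
    set x := ((n : ℝ) + 1) ^ (1 / 4 : ℝ)
    set y := (n : ℝ) ^ (1 / 4 : ℝ)
    have h2 : 1 / x ≤ 4 * (x ^ 3 - y ^ 3) := by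
      rw [div_le_iff₀ hxp]
      have e : 4 * (x ^ 3 - y ^ 3) * x - (x ^ 4 - y ^ 4)
          = (x - y) * (3 * x ^ 3 + 3 * x ^ 2 * y + 3 * x * y ^ 2 - y ^ 3) := by ring
      have h3 : y ^ 3 ≤ x ^ 3 := by gcongr
      have h4 : 0 ≤ (x - y) * (3 * x ^ 3 + 3 * x ^ 2 * y + 3 * x * y ^ 2 - y ^ 3) := by
        refine mul_nonneg (by linarith) ?_
        have : 0 ≤ 3 * x ^ 2 * y + 3 * x * y ^ 2 := by positivity
        have : 0 ≤ x ^ 3 := by positivity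
        linarith
      linarith
    linarith

theorem BoundedErr.of_decayErr {Ω : Type*} [MeasurableSpace Ω] {μ : Measure Ω} {e : ℕ → Ω → ℝ}
    {T : ℕ} {εb θ : ℝ} (hεb : 0 ≤ εb) (hθ : 0 ≤ θ) (h : DecayErr μ e T εb θ) :
    BoundedErr μ e T εb := by
  intro k hk
  filter_upwards [h k hk] with ω hω
  refine hω.trans (div_le_self hεb (Real.one_le_rpow ?_ hθ))
  linarith [(Nat.cast_nonneg k : (0 : ℝ) ≤ k)]

theorem pathLength_nonneg {p : ℕ} (ustar : ℕ → Vec p) (T : ℕ) : 0 ≤ pathLength ustar T :=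
  Finset.sum_nonneg fun _ _ => norm_nonneg _

theorem rpow_le_rate {p : ℕ} (hp : 1 ≤ p) (ustar : ℕ → Vec p) (T : ℕ) :
    (T : ℝ) ^ (3 / 4 : ℝ) ≤ rate ustar T := by
  have h1 : (1 : ℝ) ≤ (p : ℝ) ^ (2 / 3 : ℝ) :=
    Real.one_le_rpow (by exact_mod_cast hp) (by norm_num)
  have h2 := pathLength_nonneg ustar T
  have h3 : (0 : ℝ) ≤ (T : ℝ) ^ (3 / 4 : ℝ) := by positivity
  rw [rate]
  calc (T : ℝ) ^ (3 / 4 : ℝ) ≤ (p : ℝ) ^ (2 / 3 : ℝ) * (T : ℝ) ^ (3 / 4 : ℝ) :=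
        le_mul_of_one_le_left h3 h1
    _ ≤ _ := le_mul_of_one_le_right (by positivity) (by linarith)

/-- The regret bound of the descent argument, at the prescribed step size and smoothing. -/
theorem rate_balance {a b D G L M A c S : ℝ} (ha : 1 ≤ a) (hb : 1 ≤ b) (hD : 0 ≤ D)
    (hL : 0 ≤ L) (hM : 0 ≤ M) (hc : 0 ≤ c) {reg : ℝ}
    (h : 2 * (1 / (a ^ 2 * b ^ 3)) * (reg - b ^ 4 * ((2 * M + L * D) * (a / b)) - S)
      ≤ D ^ 2 + 2 * D * c
        + b ^ 4 * ((1 / (a ^ 2 * b ^ 3)) ^ 2 * (A + a ^ 3 / (a / b) * (2 * G)) ^ 2)) :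
    reg ≤ (D ^ 2 / 2 + D + 2 * M + L * D + A ^ 2 + 4 * G ^ 2) * (a ^ 2 * b ^ 3 * (c + 1)) + S := by
  -- The intended values are a = p^{1/3} and b = T^{1/4}, so that p = a³, T = b⁴, η = 1/(a²b³) and δ
  -- = a/b; A bounds the model-based direction and c is the path length.
  have ha0 : 0 < a := by linarith
  have hb0 : 0 < b := by linarith
  have h1 := mul_le_mul_of_nonneg_left h (by positivity : 0 ≤ a ^ 2 * b ^ 3 / 2)
  have e1 : a ^ 2 * b ^ 3 / 2 * (2 * (1 / (a ^ 2 * b ^ 3))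
      * (reg - b ^ 4 * ((2 * M + L * D) * (a / b)) - S))
      = reg - (2 * M + L * D) * (a * b ^ 3) - S := by field_simp
  have e2 : a ^ 2 * b ^ 3 / 2 * (D ^ 2 + 2 * D * c
        + b ^ 4 * ((1 / (a ^ 2 * b ^ 3)) ^ 2 * (A + a ^ 3 / (a / b) * (2 * G)) ^ 2))
      = (D ^ 2 / 2 + D * c) * (a ^ 2 * b ^ 3)
        + b / (2 * a ^ 2) * (A + 2 * G * (a ^ 2 * b)) ^ 2 := by
    field_simp
  rw [e1, e2] at h1
  have h2 : b / (2 * a ^ 2) * (A + 2 * G * (a ^ 2 * b)) ^ 2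
      ≤ b / (2 * a ^ 2) * (2 * A ^ 2 + 8 * G ^ 2 * (a ^ 4 * b ^ 2)) := by
    gcongr
    nlinarith [sq_nonneg (A - 2 * G * (a ^ 2 * b))]
  have e3 : b / (2 * a ^ 2) * (2 * A ^ 2 + 8 * G ^ 2 * (a ^ 4 * b ^ 2))
      = A ^ 2 * (b / a ^ 2) + 4 * G ^ 2 * (a ^ 2 * b ^ 3) := by
    field_simp
    ring
  have ha2 : 1 ≤ a ^ 2 := one_le_pow₀ ha
  have hbb : b ≤ b ^ 3 := le_self_pow₀ hb (by norm_num)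
  have h3 : b / a ^ 2 ≤ a ^ 2 * b ^ 3 :=
    (div_le_self hb0.le ha2).trans (hbb.trans (le_mul_of_one_le_left (by positivity) ha2))
  have h4 : a * b ^ 3 ≤ a ^ 2 * b ^ 3 := by
    gcongr
    exact le_self_pow₀ ha (by norm_num)
  have h5 := mul_le_mul_of_nonneg_left h3 (sq_nonneg A)
  have h6 := mul_le_mul_of_nonneg_left h4 (by positivity : 0 ≤ 2 * M + L * D)
  have h7 : 0 ≤ (D ^ 2 / 2 + 2 * M + L * D + A ^ 2 + 4 * G ^ 2) * (a ^ 2 * b ^ 3 * c)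
      + D * (a ^ 2 * b ^ 3) := by positivity
  linarith

/-! ### The regret bound at the prescribed parameters. -/

namespace Problem

variable {p q r : ℕ} {P : Problem p q r} {D G τ L M N : ℝ}
  {Ω : Type*} [m : MeasurableSpace Ω] {μ : Measure Ω}
  {ℱ : Filtration ℕ m} {v : ℕ → Ω → UnitSphere p} {δ : ℝ}
  {η : ℝ} {α : ℕ → ℝ} {w₀ : Vec p} {c₀ : Ω → ℝ} {Ĥ : ℕ → Ω → Vec p →L[ℝ] Vec q}
  {w : ℕ → Ω → Vec p} {e : ℕ → Ω → ℝ} {ustar : ℕ → Vec p}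

theorem Regular.descent_regret [IsProbabilityMeasure μ]
    (hP : P.Regular D G τ (fun _ => L) (fun _ => M) (fun _ => N)) (hv : IsExploration μ ℱ v)
    (hL : 0 ≤ L) (hD : 0 ≤ D) (hM : 0 ≤ M) (hN : 0 ≤ N) (hη : 0 ≤ η) (hτ : 0 < τ) (hδ : 0 < δ)
    (hδτ : δ ≤ τ) (hustar : ∀ k, P.IsOptimal k (ustar k))
    (hĤ : ∀ k, Measurable[ℱ k] (Ĥ k)) (hα : ∀ k, 0 ≤ α k ∧ α k ≤ 1) (hw₀ : w₀ ∈ P.U)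
    (hc₀ : Measurable[ℱ 0] c₀)
    (hw : ∀ k ω, w k ω = P.candidate η δ α w₀ (c₀ ω) (fun j => Ĥ j ω) (fun j => (v j ω : Vec p)) k)
    (he : ∀ k ω, e k ω = P.sensError η δ α w₀ (c₀ ω) (fun j => Ĥ j ω) (fun j => (v j ω : Vec p)) k)
    {T : ℕ} {εb : ℝ} (hε : BoundedErr μ e T εb) :
    2 * η * (P.regret μ w ustar T - T * ((2 * M + L * D) * δ)
        - N * D * ∑ k ∈ Finset.Icc 1 T, α k * ∫ ω, e k ω ∂μ)
      ≤ D ^ 2 + 2 * D * pathLength ustar T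
        + T * (η ^ 2 * (M + εb * N + (p : ℝ) / δ * (2 * G)) ^ 2) := by
  have hwm := hP.measurable_candidate hv hĤ hw₀ hc₀ hw
  have hwU : ∀ k ω, w k ω ∈ P.U := fun k ω => hw k ω ▸ hP.candidate_mem hw₀ _ _ _ _
  have hsq : ∀ i k ω, ‖w i ω - ustar k‖ ^ 2 ≤ D ^ 2 := fun i k ω => by
    have := hP.U_diam _ (hwU i ω) _ (hustar k).1
    gcongr
  have hni : ∀ i k, Integrable (fun ω => ‖w i ω - ustar k‖ ^ 2) μ := fun i k => by
    refine Integrable.of_bound (((hwm i).sub_const _).norm.pow_const 2).aestronglyMeasurable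
      (D ^ 2) (Filter.Eventually.of_forall fun ω => ?_)
    rw [Real.norm_of_nonneg (by positivity)]
    exact hsq i k ω
  have hsum := two_mul_sum_le_of_descent (T := T) (η := η)
    (β := η ^ 2 * (M + εb * N + (p : ℝ) / δ * (2 * G)) ^ 2)
    -- The potential pairs w_{k+1} with the comparator at time k. Its initial value involves w_1,
    -- which lies in the constraint set whatever the initial datum was, so step 0 never has to be
    -- estimated.
    (a := fun k => ∫ ω, ‖w (k + 1) ω - ustar k‖ ^ 2 ∂μ)
    (E := fun k => (∫ ω, P.reduced k (w k ω) ∂μ) - P.reduced k (ustar k)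
        - (2 * M + L * D) * δ - N * D * (α k * ∫ ω, e k ω ∂μ))
    (Δ := fun k => 2 * D * ‖ustar k - ustar (k - 1)‖)
    (integral_nonneg fun ω => by positivity) (fun k hk => by
      obtain ⟨j, rfl⟩ : ∃ j, k = j + 1 := ⟨k - 1, by have := (Finset.mem_Icc.1 hk).1; omega⟩
      have h1 := hP.integral_norm_sq_candidate_succ_sub_le hv hL hD hM hN hη hτ hδ hδτ hĤ hα hw₀
        hc₀ hw he j (hε _ hk) (hustar (j + 1)).1
      have h2 : ∫ ω, ‖w (j + 1) ω - ustar (j + 1)‖ ^ 2 ∂μ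
          ≤ ∫ ω, ‖w (j + 1) ω - ustar j‖ ^ 2 ∂μ + 2 * D * ‖ustar (j + 1) - ustar j‖ := by
        have h3 := integral_mono (hni (j + 1) (j + 1))
          ((hni (j + 1) j).add (integrable_const (2 * D * ‖ustar (j + 1) - ustar j‖)))
          (fun ω => norm_sub_sq_le_add (hP.U_diam _ (hwU (j + 1) ω) _ (hustar (j + 1)).1)
            (hP.U_diam _ (hwU (j + 1) ω) _ (hustar j).1))
        rw [integral_add' (hni (j + 1) j) (integrable_const _)] at h3
        simpa using h3
      simp only [Nat.add_sub_cancel]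
      linarith)
  have ha0 : ∫ ω, ‖w (0 + 1) ω - ustar 0‖ ^ 2 ∂μ ≤ D ^ 2 := by
    have := integral_mono (hni (0 + 1) 0) (integrable_const (D ^ 2)) (hsq (0 + 1) 0)
    simpa using this
  have e1 : ∑ k ∈ Finset.Icc 1 T, ((∫ ω, P.reduced k (w k ω) ∂μ) - P.reduced k (ustar k)
        - (2 * M + L * D) * δ - N * D * (α k * ∫ ω, e k ω ∂μ))
      = P.regret μ w ustar T - T * ((2 * M + L * D) * δ)
        - N * D * ∑ k ∈ Finset.Icc 1 T, α k * ∫ ω, e k ω ∂μ := by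
    rw [Finset.sum_sub_distrib, Finset.sum_sub_distrib, ← Finset.mul_sum _ _ (N * D),
      Finset.sum_const, Nat.card_Icc, Nat.add_sub_cancel, nsmul_eq_mul, regret]
  rw [e1, ← Finset.mul_sum] at hsum
  rw [pathLength]
  linarith

/-- Nonnegativity removes the absolute value from the regret. The crude upper bound settles the case
of truncated smoothing. -/
theorem Regular.regret_nonneg_and_le [IsProbabilityMeasure μ]
    (hP : P.Regular D G τ (fun _ => L) (fun _ => M) (fun _ => N))
    (hustar : ∀ k, P.IsOptimal k (ustar k)) (hwU : ∀ k ω, w k ω ∈ P.U)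
    (hri : ∀ k, Integrable (fun ω => P.reduced k (w k ω)) μ) (T : ℕ) :
    0 ≤ P.regret μ w ustar T ∧ P.regret μ w ustar T ≤ T * (2 * G) := by
  constructor
  · refine Finset.sum_nonneg fun k _ => ?_
    have := integral_mono (integrable_const (P.reduced k (ustar k))) (hri k)
      fun ω => (hustar k).2 _ (hwU k ω)
    simp only [integral_const, probReal_univ, one_smul] at this
    linarith
  · have h : ∀ k ∈ Finset.Icc 1 T,
        (∫ ω, P.reduced k (w k ω) ∂μ) - P.reduced k (ustar k) ≤ 2 * G := fun k _ => by
      have := integral_mono (hri k) (integrable_const G)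
        fun ω => (abs_le.1 (hP.abs_reduced_le k (hwU k ω))).2
      simp only [integral_const, probReal_univ, one_smul] at this
      linarith [(abs_le.1 (hP.abs_reduced_le k (hustar k).1)).1]
    have := Finset.sum_le_card_nsmul _ _ _ h
    rwa [Nat.card_Icc, Nat.add_sub_cancel, nsmul_eq_mul] at this

/-- The regret bound in terms of the expected sensitivity errors. -/
theorem Regular.abs_regret_le [IsProbabilityMeasure μ]
    (hP : P.Regular D G τ (fun _ => L) (fun _ => M) (fun _ => N)) (hv : IsExploration μ ℱ v)
    (hL : 0 ≤ L) (hD : 0 ≤ D) (hG : 0 ≤ G) (hM : 0 ≤ M) (hN : 0 ≤ N) (hτ : 0 < τ)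
    (hustar : ∀ k, P.IsOptimal k (ustar k)) (hĤ : ∀ k, Measurable[ℱ k] (Ĥ k))
    (hα : ∀ k, 0 ≤ α k ∧ α k ≤ 1) (hw₀ : w₀ ∈ P.U) (hc₀ : Measurable[ℱ 0] c₀)
    {T : ℕ} (hp : 1 ≤ p) (hT : 1 ≤ T)
    (hw : ∀ k ω, w k ω = P.candidate (stepSize p T) (smoothing p T τ) α w₀ (c₀ ω)
      (fun j => Ĥ j ω) (fun j => (v j ω : Vec p)) k)
    (he : ∀ k ω, e k ω = P.sensError (stepSize p T) (smoothing p T τ) α w₀ (c₀ ω)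
      (fun j => Ĥ j ω) (fun j => (v j ω : Vec p)) k)
    {εb : ℝ} (hε : BoundedErr μ e T εb) :
    |P.regret μ w ustar T| ≤ (D ^ 2 / 2 + D + 2 * M + L * D + (M + εb * N) ^ 2 + 4 * G ^ 2
        + 2 * G / τ) * rate ustar T + N * D * ∑ k ∈ Finset.Icc 1 T, α k * ∫ ω, e k ω ∂μ := by
  have hwU : ∀ k ω, w k ω ∈ P.U := fun k ω => hw k ω ▸ hP.candidate_mem hw₀ _ _ _ _
  obtain ⟨h0, hle⟩ := hP.regret_nonneg_and_le hustar hwU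
    (fun k => hP.integrable_reduced_candidate hv hĤ hw₀ hc₀ hw k k) T
  have hp1 : (1 : ℝ) ≤ p := by exact_mod_cast hp
  have hT1 : (1 : ℝ) ≤ T := by exact_mod_cast hT
  have ha : (1 : ℝ) ≤ (p : ℝ) ^ (1 / 3 : ℝ) := Real.one_le_rpow hp1 (by norm_num)
  have hb : (1 : ℝ) ≤ (T : ℝ) ^ (1 / 4 : ℝ) := Real.one_le_rpow hT1 (by norm_num)
  have ha2 : (p : ℝ) ^ (2 / 3 : ℝ) = ((p : ℝ) ^ (1 / 3 : ℝ)) ^ 2 := by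
    rw [← Real.rpow_natCast, ← Real.rpow_mul (by positivity)]; norm_num
  have ha3 : (p : ℝ) = ((p : ℝ) ^ (1 / 3 : ℝ)) ^ 3 := by
    rw [← Real.rpow_natCast, ← Real.rpow_mul (by positivity)]; norm_num
  have hb3 : (T : ℝ) ^ (3 / 4 : ℝ) = ((T : ℝ) ^ (1 / 4 : ℝ)) ^ 3 := by
    rw [← Real.rpow_natCast, ← Real.rpow_mul (by positivity)]; norm_num
  have hb4 : (T : ℝ) = ((T : ℝ) ^ (1 / 4 : ℝ)) ^ 4 := by
    rw [← Real.rpow_natCast, ← Real.rpow_mul (by positivity)]; norm_num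
  have hc := pathLength_nonneg ustar T
  have hS : 0 ≤ N * D * ∑ k ∈ Finset.Icc 1 T, α k * ∫ ω, e k ω ∂μ := by
    refine mul_nonneg (by positivity) (Finset.sum_nonneg fun k _ => mul_nonneg (hα k).1 ?_)
    exact integral_nonneg fun ω => by rw [he]; exact norm_nonneg _
  rw [abs_of_nonneg h0]
  have hη : stepSize p T = 1 / (((p : ℝ) ^ (1 / 3 : ℝ)) ^ 2 * ((T : ℝ) ^ (1 / 4 : ℝ)) ^ 3) := by
    rw [stepSize, ha2, hb3]
  have hrate : rate ustar T = ((p : ℝ) ^ (1 / 3 : ℝ)) ^ 2 * ((T : ℝ) ^ (1 / 4 : ℝ)) ^ 3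
      * (pathLength ustar T + 1) := by
    rw [rate, ha2, hb3]
  set a := (p : ℝ) ^ (1 / 3 : ℝ)
  set b := (T : ℝ) ^ (1 / 4 : ℝ)
  have ha0 : 0 < a := by linarith
  have hb0 : 0 < b := by linarith
  have hδ : smoothing p T τ = min (a / b) τ := rfl
  rw [hrate]
  set K₁ := D ^ 2 / 2 + D + 2 * M + L * D + (M + εb * N) ^ 2 + 4 * G ^ 2 with hK₁
  have hK₁0 : 0 ≤ K₁ := by positivity
  have hR0 : 0 ≤ a ^ 2 * b ^ 3 * (pathLength ustar T + 1) := by positivity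
  rcases le_total (a / b) τ with hcase | hcase
  · rw [min_eq_left hcase] at hδ
    have hdes := hP.descent_regret hv hL hD hM hN (by rw [hη]; positivity) hτ
      (by rw [hδ]; positivity) (by rwa [hδ]) hustar hĤ hα hw₀ hc₀ hw he hε
    rw [hδ, hη, hb4, ha3] at hdes
    have hfin := rate_balance ha hb hD hL hM hc hdes
    rw [← hK₁] at hfin
    have : 0 ≤ 2 * G / τ * (a ^ 2 * b ^ 3 * (pathLength ustar T + 1)) := by positivity
    rw [add_mul]
    linarith
  -- When δ = τ the horizon is short relative to the dimension: one factor T^{1/4} of T can be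
  -- traded for p^{1/3}/τ, which turns 2GT into a multiple of the rate. This is the source of the
  -- constant 2G/τ.
  · have h1 : b ≤ a / τ := by
      rw [le_div_iff₀ hb0] at hcase
      rw [le_div_iff₀ hτ]
      linarith
    have h2 : (T : ℝ) * (2 * G) ≤ 2 * G / τ * (a ^ 2 * b ^ 3 * (pathLength ustar T + 1)) := by
      calc (T : ℝ) * (2 * G) = b * b ^ 3 * (2 * G) := by rw [hb4]; ring
        _ ≤ a / τ * b ^ 3 * (2 * G) := by gcongr
        _ = 2 * G / τ * (a * b ^ 3) := by ring
        _ ≤ 2 * G / τ * (a ^ 2 * b ^ 3) := by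
          have : a ≤ a ^ 2 := le_self_pow₀ ha (by norm_num)
          exact mul_le_mul_of_nonneg_left (mul_le_mul_of_nonneg_right this (by positivity))
            (by positivity)
        _ ≤ _ := mul_le_mul_of_nonneg_left
          (le_mul_of_one_le_right (by positivity) (by linarith)) (by positivity)
    have h3 := mul_nonneg hK₁0 hR0
    rw [add_mul]
    linarith

end Problem

/-- Weights of order `(k+1)^{-(1/4-θ)}` balance errors of order `(k+1)^{-θ}`. -/
theorem sum_weight_mul_integral_le {Ω : Type*} [MeasurableSpace Ω] {μ : Measure Ω}
    [IsProbabilityMeasure μ] {e : ℕ → Ω → ℝ} {α : ℕ → ℝ} {T : ℕ} {εb θ C : ℝ} (hεb : 0 ≤ εb)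
    (hC : 0 ≤ C) (hα0 : ∀ k, 0 ≤ α k) (hei : ∀ k ∈ Finset.Icc 1 T, Integrable (e k) μ)
    (he : ∀ k ∈ Finset.Icc 1 T, ∀ᵐ ω ∂μ, e k ω ≤ εb / ((k : ℝ) + 1) ^ θ)
    (hα : ∀ k, α k = min (C / ((k : ℝ) + 1) ^ (1 / 4 - θ)) 1) :
    ∑ k ∈ Finset.Icc 1 T, α k * ∫ ω, e k ω ∂μ ≤ C * εb * (4 * (T : ℝ) ^ (3 / 4 : ℝ)) := by
  refine le_trans ?_ (mul_le_mul_of_nonneg_left (sum_inv_rpow_quarter_le T) (by positivity))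
  rw [Finset.mul_sum]
  refine Finset.sum_le_sum fun k hk => ?_
  have h1 : ∫ ω, e k ω ∂μ ≤ εb / ((k : ℝ) + 1) ^ θ := by
    simpa using integral_mono_ae (hei k hk) (integrable_const _) (he k hk)
  have hk0 : (0 : ℝ) < (k : ℝ) + 1 := by positivity
  have h2 : α k ≤ C / ((k : ℝ) + 1) ^ (1 / 4 - θ) := by rw [hα]; exact min_le_left _ _
  calc α k * ∫ ω, e k ω ∂μ ≤ α k * (εb / ((k : ℝ) + 1) ^ θ) :=
        mul_le_mul_of_nonneg_left h1 (hα0 k)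
    _ ≤ C / ((k : ℝ) + 1) ^ (1 / 4 - θ) * (εb / ((k : ℝ) + 1) ^ θ) := by gcongr
    _ = C * εb * (1 / ((k : ℝ) + 1) ^ (1 / 4 : ℝ)) := by
      rw [div_mul_div_comm, ← Real.rpow_add hk0, sub_add_cancel]
      ring

end GrayBox

theorem theorem4 (D G τ Lb Mb MΦb εb C : ℝ) (hD : 0 < D) (hG : 0 ≤ G) (hτ : 0 < τ)
    (hεb : 0 < εb) (hC : 0 < C) :
    ∃ K : ℝ, 0 < K ∧
      ∀ (p q r T : ℕ) (_hp : 1 ≤ p) (_hT : 1 ≤ T)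
        -- the problems and their optimal points
        (P : GrayBox.Problem p q r) (L M MΦ : ℕ → ℝ)
        (_hP : P.Regular D G τ L M MΦ)
        (_hL : ∀ k, L k ≤ Lb) (_hM : ∀ k, M k ≤ Mb) (_hMΦ : ∀ k, MΦ k ≤ MΦb)
        (ustar : ℕ → GrayBox.Vec p) (_hustar : ∀ k, P.IsOptimal k (ustar k))
        -- randomness, exploration signal and approximate sensitivities
        (Ω : Type*) [m : MeasurableSpace Ω] (μ : MeasureTheory.Measure Ω)
        [MeasureTheory.IsProbabilityMeasure μ] (ℱ : MeasureTheory.Filtration ℕ m)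
        (v : ℕ → Ω → GrayBox.UnitSphere p) (_hv : GrayBox.IsExploration μ ℱ v)
        (Ĥ : ℕ → Ω → GrayBox.Vec p →L[ℝ] GrayBox.Vec q) (_hĤ : ∀ k, Measurable[ℱ k] (Ĥ k))
        -- combination coefficients and initialisation
        (α : ℕ → ℝ) (_hα : ∀ k, 0 ≤ α k ∧ α k ≤ 1)
        (w₀ : GrayBox.Vec p) (_hw₀ : w₀ ∈ P.U) (c₀ : Ω → ℝ) (_hc₀ : Measurable[ℱ 0] c₀)
        -- the candidate solutions and the sensitivity errors of the closed loop
        (w : ℕ → Ω → GrayBox.Vec p)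
        (_hw : ∀ k ω, w k ω =
          P.candidate (GrayBox.stepSize p T) (GrayBox.smoothing p T τ) α w₀ (c₀ ω)
            (fun j => Ĥ j ω) (fun j => (v j ω : GrayBox.Vec p)) k)
        (e : ℕ → Ω → ℝ)
        (_he : ∀ k ω, e k ω =
          P.sensError (GrayBox.stepSize p T) (GrayBox.smoothing p T τ) α w₀ (c₀ ω)
            (fun j => Ĥ j ω) (fun j => (v j ω : GrayBox.Vec p)) k),
        -- the expectations in the regret are those of integrable random variables
        (∀ k ∈ Finset.Icc 1 T, MeasureTheory.Integrable (fun ω => P.reduced k (w k ω)) μ) ∧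
        -- general bound, for each of the three kinds of sensitivity errors
        ((GrayBox.BoundedErr μ e T εb ∨
            (∃ θ : ℝ, 1 / 4 ≤ θ ∧ GrayBox.DecayErr μ e T εb θ) ∨
            (∃ θ : ℝ, 0 < θ ∧ θ < 1 / 4 ∧ GrayBox.DecayErr μ e T εb θ)) →
          (∀ k ∈ Finset.Icc 1 T, MeasureTheory.Integrable (e k) μ) ∧
          |P.regret μ w ustar T| ≤ K * (GrayBox.rate ustar T + ∑ k ∈ Finset.Icc 1 T, α k * ∫ ω, e k ω ∂μ)) ∧
        -- bounded sensitivity errors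
        (GrayBox.BoundedErr μ e T εb →
          (∀ k, α k = min (C / ((k : ℝ) + 1) ^ (1 / 4 : ℝ)) 1) →
          |P.regret μ w ustar T| ≤ K * GrayBox.rate ustar T) ∧
        -- slowly decaying sensitivity errors
        (∀ θ : ℝ, 0 < θ → θ < 1 / 4 → GrayBox.DecayErr μ e T εb θ →
          (∀ k, α k = min (C / ((k : ℝ) + 1) ^ (1 / 4 - θ)) 1) →
          |P.regret μ w ustar T| ≤ K * GrayBox.rate ustar T) := by
  -- Absolute values appear because `Lb`, `Mb`, `MΦb` are not assumed nonnegative. The last two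
  -- summands cover the coefficient of the error sum and the value of that sum under the prescribed
  -- weights.
  refine ⟨D ^ 2 / 2 + D + 2 * |Mb| + |Lb| * D + (|Mb| + εb * |MΦb|) ^ 2 + 4 * G ^ 2 + 2 * G / τ
    + |MΦb| * D + |MΦb| * D * (C * εb * 4), by positivity, ?_⟩
  intro p q r T hp hT P L M MΦ hP hL hM hMΦ ustar hustar Ω m μ _ ℱ v hv Ĥ hĤ α hα w₀ hw₀ c₀ hc₀
    w hw e he
  have hP' : P.Regular D G τ (fun _ => |Lb|) (fun _ => |Mb|) (fun _ => |MΦb|) :=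
    hP.mono (fun k => (hL k).trans (le_abs_self _)) (fun k => (hM k).trans (le_abs_self _))
      (fun k => (hMΦ k).trans (le_abs_self _))
  set K₀ := D ^ 2 / 2 + D + 2 * |Mb| + |Lb| * D + (|Mb| + εb * |MΦb|) ^ 2 + 4 * G ^ 2 + 2 * G / τ
  have hK₀0 : 0 ≤ K₀ := by positivity
  have hmain : GrayBox.BoundedErr μ e T εb → |P.regret μ w ustar T| ≤ K₀ * GrayBox.rate ustar T
      + |MΦb| * D * ∑ k ∈ Finset.Icc 1 T, α k * ∫ ω, e k ω ∂μ := fun hε =>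
    hP'.abs_regret_le hv (abs_nonneg _) hD.le hG (abs_nonneg _) (abs_nonneg _) hτ hustar hĤ hα hw₀
      hc₀ hp hT hw he hε
  clear_value K₀
  have hei : GrayBox.BoundedErr μ e T εb →
      ∀ k ∈ Finset.Icc 1 T, MeasureTheory.Integrable (e k) μ := fun hε k hk =>
    hP'.integrable_sensError hv hĤ hw₀ hc₀ he (hε k hk)
  have hTrate := GrayBox.rpow_le_rate hp ustar T
  have hrate : 0 ≤ GrayBox.rate ustar T := le_trans (by positivity) hTrate
  have hS : 0 ≤ ∑ k ∈ Finset.Icc 1 T, α k * ∫ ω, e k ω ∂μ :=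
    Finset.sum_nonneg fun k _ => mul_nonneg (hα k).1
      (MeasureTheory.integral_nonneg fun ω => by rw [he]; exact norm_nonneg _)
  have hN : 0 ≤ |MΦb| * D := by positivity
  have hNC : 0 ≤ |MΦb| * D * (C * εb * 4) := by positivity
  have hweighted : ∀ θ : ℝ, GrayBox.BoundedErr μ e T εb →
      (∀ k ∈ Finset.Icc 1 T, ∀ᵐ ω ∂μ, e k ω ≤ εb / ((k : ℝ) + 1) ^ θ) →
      (∀ k, α k = min (C / ((k : ℝ) + 1) ^ (1 / 4 - θ)) 1) →
      |P.regret μ w ustar T| ≤ (K₀ + |MΦb| * D + |MΦb| * D * (C * εb * 4))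
        * GrayBox.rate ustar T := by
    intro θ hε hdec hαeq
    have h1 := GrayBox.sum_weight_mul_integral_le hεb.le hC.le (fun k => (hα k).1) (hei hε) hdec
      hαeq
    have h2 : ∑ k ∈ Finset.Icc 1 T, α k * ∫ ω, e k ω ∂μ ≤ C * εb * 4 * GrayBox.rate ustar T := by
      refine h1.trans ?_
      rw [← mul_assoc]
      exact mul_le_mul_of_nonneg_left hTrate (by positivity)
    have h3 := mul_le_mul_of_nonneg_left h2 hN
    have h4 := mul_nonneg hN hrate
    have h5 := hmain hε
    linarith
  refine ⟨fun k _ => hP'.integrable_reduced_candidate hv hĤ hw₀ hc₀ hw k k, fun hcases => ?_,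
    fun hε hαeq => ?_, fun θ hθ _ hdec hαeq => ?_⟩
  · have hε : GrayBox.BoundedErr μ e T εb := by
      rcases hcases with h | ⟨θ, hθ, h⟩ | ⟨θ, hθ, -, h⟩
      · exact h
      · exact .of_decayErr hεb.le (by linarith) h
      · exact .of_decayErr hεb.le hθ.le h
    refine ⟨hei hε, (hmain hε).trans ?_⟩
    have h1 := mul_nonneg hN hrate
    have h2 := mul_nonneg hNC hrate
    have h3 := mul_nonneg hK₀0 hS
    have h4 := mul_nonneg hNC hS
    linarith
  -- Bounded errors are the case θ = 0 of decaying errors, with the same weight formula.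
  · exact hweighted 0 hε (fun k hk => by simpa using hε k hk) (by simpa using hαeq)
  · exact hweighted θ (.of_decayErr hεb.le hθ.le hdec) hdec hαeq
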